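/- Let $\mathcal H$ be a complex Hilbert space, $U(\mathcal H)$ its unitary group and $\mathrm{Conj}(\mathcal H)$ the set of antiunitary involutions of $\mathcal H$. A standard subspace is a closed real subspace $V\subseteq\mathcal H$ with $V\cap iV=\{0\}$ and $V+iV$ dense; $\mathrm{Stand}(\mathcal H)$ is the set of all standard subspaces. For $V\in\mathrm{Stand}(\mathcal H)$ let $S_V$ be the antilinear operator with domain $V+iV$ and $S_V(v+iw)=v-iw$ ($v,w\in V$), let $\Delta_V=S_V^*S_V$, and let $J_V\in\mathrm{Conj}(\mathcal H)$ be determined by the polar decomposition $S_V=J_V\Delta_V^{1/2}$ (that there is exactly one such $J_V$ is part of the statement). Put $V\bullet W:=J_VJ_WW$ on $\mathrm{Stand}(\mathcal H)$. A reflection space is a set $M$ with a product $\bullet$ such that $x\bullet x=x$, $x\bullet(x\bullet y)=y$ and $x\bullet(y\bullet z)=(x\bullet y)\bullet(x\bullet z)$; a morphism is a map that preserves the products. Fix $J\in\mathrm{Conj}(\mathcal H)$. Let $\tau(g)=JgJ$ on $U(\mathcal H)$, let $\mathcal H^J=\{x: Jx=x\}$ be the real Hilbert space of $J$-fixed vectors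 with orthogonal group $O(\mathcal H^J)$, and let $\mathrm{Stand}_J(\mathcal H)=\{V\in\mathrm{Stand}(\mathcal H): J_V=J\}$. Then restriction to $\mathcal H^J$ is an isomorphism from $U(\mathcal H)^\tau=\{g: \tau(g)=g\}$ onto $O(\mathcal H^J)$; we identify the two groups. This group leaves $\mathrm{Stand}_J(\mathcal H)$ invariant under $(h,V)\mapsto hV$, and $U(\mathcal H)\times_{O(\mathcal H^J)}\mathrm{Stand}_J(\mathcal H)$ denotes the set of orbits $[g,V]$ of the action $h.(g,V)=(gh^{-1},hV)$ on $U(\mathcal H)\times\mathrm{Stand}_J(\mathcal H)$. Moreover: 1. The map $U(\mathcal H)\times\mathrm{Stand}_J(\mathcal H)\to\mathrm{Stand}(\mathcal H)$, $(g,V)\mapsto gV$, is surjective. 2. $\mathrm{Stand}(\mathcal H)$ with $\bullet$ is a reflection space; the product $[g_1,V_1]\bullet[g_2,V_2]=[g_1\tau(g_1^{-1}g_2),V_2]$ is well defined and makes $U(\mathcal H)\times_{O(\mathcal H^J)}\mathrm{Stand}_J(\mathcal H)$ a reflection space; and the map in 1 factors to a bijection $$U(\mathcal H)\times_{O(\mathcal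 H^J)}\mathrm{Stand}_J(\mathcal H)\to\mathrm{Stand}(\mathcal H),\qquad [g,V]\mapsto gV,$$ which is an isomorphism of reflection spaces and is equivariant for the actions $g.[g',V]=[gg',V]$ and $V\mapsto gV$ of $U(\mathcal H)$. 3. $\mathrm{Stand}_J(\mathcal H)$ is a trivial reflection subspace of $\mathrm{Stand}(\mathcal H)$: it is closed under $\bullet$, and $V_1\bullet V_2=V_2$ for $V_1,V_2\in\mathrm{Stand}_J(\mathcal H)$. -/

import Mathlib

/-! ### Reflection spaces -/

/-- The axioms (S1)-(S3) of a reflection space for a binary operation `op x y = x • y = s_x(y)`. -/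
structure IsReflectionSpace {M : Type*} (op : M → M → M) : Prop where
  self : ∀ x, op x x = x
  involutive : ∀ x y, op x (op x y) = y
  distrib : ∀ x y z, op x (op y z) = op (op x y) (op x z)

/-- `f` is a morphism of reflection spaces. -/
def IsReflectionMorphism {M N : Type*} (opM : M → M → M) (opN : N → N → N) (f : M → N) : Prop :=
  ∀ x y, f (opM x y) = opN (f x) (f y)

/-- `F` is closed under the product, and the induced product is the trivial one. -/
def IsTrivialReflectionSubspace {M : Type*} (op : M → M → M) (F : Set M) : Prop :=
  ∀ x ∈ F, ∀ y ∈ F, op x y ∈ F ∧ op x y = y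

noncomputable section

/-! ### Conjugations -/

/-- `Conj(H)`: the antiunitary involutions of `H`. -/
structure Conjugation (H : Type*) [NormedAddCommGroup H] [InnerProductSpace ℂ H] where
  toEquiv : H ≃ₗᵢ⋆[ℂ] H
  involutive : ∀ x, toEquiv (toEquiv x) = x

/-- Complex conjugation of the coefficients in a Hilbert basis is a conjugation. -/
instance Conjugation.instNonempty {H : Type*} [NormedAddCommGroup H] [InnerProductSpace ℂ H]
    [CompleteSpace H] : Nonempty (Conjugation H) := by
  obtain ⟨w, b, -⟩ := exists_hilbertBasis ℂ H
  exact ⟨⟨(b.repr.trans (starₗᵢ ℂ)).trans b.repr.symm, fun x => by simp⟩⟩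

namespace Conjugation

variable {H : Type*} [NormedAddCommGroup H] [InnerProductSpace ℂ H] (J : Conjugation H)

/-- A conjugation as a real-linear homeomorphism. -/
def toRealCLE : H ≃L[ℝ] H where
  toFun := J.toEquiv
  invFun := J.toEquiv
  left_inv := J.involutive
  right_inv := J.involutive
  map_add' := map_add J.toEquiv
  map_smul' r x := by
    have h := J.toEquiv.map_smulₛₗ (r : ℂ) x
    simpa using h
  continuous_toFun := J.toEquiv.continuous
  continuous_invFun := J.toEquiv.continuous

/-- The conjugate `J g J` of a unitary operator `g`. -/
def conjUnitary (g : H ≃ₗᵢ[ℂ] H) : H ≃ₗᵢ[ℂ] H := (J.toEquiv.trans g).trans J.toEquiv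

@[simp]
lemma conjUnitary_apply (g : H ≃ₗᵢ[ℂ] H) (x : H) :
    J.conjUnitary g x = J.toEquiv (g (J.toEquiv x)) := rfl

/-- The involutive automorphism `τ(g) = J g J` of the unitary group. -/
def tau : (H ≃ₗᵢ[ℂ] H) ≃* (H ≃ₗᵢ[ℂ] H) where
  toFun := J.conjUnitary
  invFun := J.conjUnitary
  left_inv g := by ext x; simp [J.involutive]
  right_inv g := by ext x; simp [J.involutive]
  map_mul' g h := by ext x; simp [J.involutive]

@[simp]
lemma tau_apply (g : H ≃ₗᵢ[ℂ] H) (x : H) : J.tau g x = J.toEquiv (g (J.toEquiv x)) := rfl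

/-- The real Hilbert space `H^J` of fixed points of `J`. -/
def fixedSpace : Submodule ℝ H where
  carrier := {x | J.toEquiv x = x}
  zero_mem' := map_zero J.toEquiv
  add_mem' {x y} hx hy := by
    change J.toEquiv (x + y) = x + y
    rw [map_add, show J.toEquiv x = x from hx, show J.toEquiv y = y from hy]
  smul_mem' r x hx := by
    change J.toRealCLE (r • x) = r • x
    rw [map_smul]
    exact congrArg (r • ·) hx

lemma mem_fixedSpace {x : H} : x ∈ J.fixedSpace ↔ J.toEquiv x = x := Iff.rfl

/-- The fixed point group `U(H)^τ = {g | JgJ = g}`, which is the stabilizer of `J` in `U(H)`. By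
restriction to `H^J` it is identified with `O(H^J)`, see `restrict`. -/
def fixedUnitary : Subgroup (H ≃ₗᵢ[ℂ] H) where
  carrier := {g | J.tau g = g}
  one_mem' := map_one J.tau
  mul_mem' {g h} hg hh := by
    change J.tau (g * h) = g * h
    rw [map_mul, show J.tau g = g from hg, show J.tau h = h from hh]
  inv_mem' {g} hg := by
    change J.tau g⁻¹ = g⁻¹
    rw [map_inv, show J.tau g = g from hg]

lemma mem_fixedUnitary {g : H ≃ₗᵢ[ℂ] H} : g ∈ J.fixedUnitary ↔ J.tau g = g := Iff.rfl

lemma apply_mem_fixedSpace {g : H ≃ₗᵢ[ℂ] H} (hg : g ∈ J.fixedUnitary) {x : H}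
    (hx : x ∈ J.fixedSpace) : g x ∈ J.fixedSpace := by
  have h : J.tau g x = g x := by rw [J.mem_fixedUnitary.1 hg]
  rw [tau_apply, J.mem_fixedSpace.1 hx] at h
  exact h

/-- The restriction homomorphism from `U(H)^τ` to the orthogonal group `O(H^J)` of the real Hilbert
space `H^J`. -/
def restrict : J.fixedUnitary →* (J.fixedSpace ≃ₗᵢ[ℝ] J.fixedSpace) where
  toFun g :=
    { toFun := fun x => ⟨(g : H ≃ₗᵢ[ℂ] H) x, J.apply_mem_fixedSpace g.2 x.2⟩
      invFun := fun x =>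
        ⟨((g⁻¹ : J.fixedUnitary) : H ≃ₗᵢ[ℂ] H) x, J.apply_mem_fixedSpace (g⁻¹).2 x.2⟩
      left_inv := fun x => Subtype.ext (LinearIsometryEquiv.symm_apply_apply (g : H ≃ₗᵢ[ℂ] H) x)
      right_inv := fun x => Subtype.ext (LinearIsometryEquiv.apply_symm_apply (g : H ≃ₗᵢ[ℂ] H) x)
      map_add' := fun x y => Subtype.ext (map_add (g : H ≃ₗᵢ[ℂ] H) (x : H) y)
      map_smul' := fun r x => Subtype.ext (by
        have h := (g : H ≃ₗᵢ[ℂ] H).map_smul (r : ℂ) (x : H)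
        simpa using h)
      norm_map' := fun x => (g : H ≃ₗᵢ[ℂ] H).norm_map (x : H) }
  map_one' := rfl
  map_mul' _ _ := rfl

end Conjugation

/-! ### Standard subspaces and their modular conjugations -/

namespace StandardSubspace

variable {H : Type*} [NormedAddCommGroup H] [InnerProductSpace ℂ H]

lemma neg_mem_iff' (V : ClosedSubmodule ℝ H) (x : H) : -x ∈ V ↔ x ∈ V :=
  neg_mem_iff (H := V.toSubmodule) (x := x)

lemma sub_mem' (V : ClosedSubmodule ℝ H) {x y : H} (hx : x ∈ V) (hy : y ∈ V) : x - y ∈ V :=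
  sub_mem (H := V.toSubmodule) hx hy

lemma mem_mulI_iff (V : ClosedSubmodule ℝ H) (x : H) : x ∈ V.mulI ↔ Complex.I • x ∈ V := by
  rw [ClosedSubmodule.mem_mapEquiv_iff, scalarSMulCLE_symm_apply]
  have h : (Complex.UnitI⁻¹ • x : H) = -(Complex.I • x) := by
    simp [Units.smul_def]
  rw [h]
  exact neg_mem_iff' V _

lemma mulI_mapEquiv (e : H ≃L[ℝ] H)
    (he : (∀ x, e (Complex.I • x) = Complex.I • e x) ∨
      (∀ x, e (Complex.I • x) = -(Complex.I • e x)))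
    (V : ClosedSubmodule ℝ H) : (V.mapEquiv e).mulI = V.mulI.mapEquiv e := by
  have key : ∀ x, x ∈ (V.mapEquiv e).mulI ↔ x ∈ V.mulI.mapEquiv e := by
    intro x
    rw [mem_mulI_iff, ClosedSubmodule.mem_mapEquiv_iff, ClosedSubmodule.mem_mapEquiv_iff,
      mem_mulI_iff]
    rcases he with he | he
    · have h : e.symm (Complex.I • x) = Complex.I • e.symm x := by
        rw [ContinuousLinearEquiv.symm_apply_eq, he, e.apply_symm_apply]
      rw [h]
    · have h : e.symm (Complex.I • x) = -(Complex.I • e.symm x) := by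
        rw [ContinuousLinearEquiv.symm_apply_eq, map_neg, he, e.apply_symm_apply, neg_neg]
      rw [h]
      exact neg_mem_iff' V _
  exact SetLike.ext key

/-- The image of a standard subspace under a complex linear or antilinear homeomorphism. -/
def image (e : H ≃L[ℝ] H)
    (he : (∀ x, e (Complex.I • x) = Complex.I • e x) ∨
      (∀ x, e (Complex.I • x) = -(Complex.I • e x)))
    (V : StandardSubspace H) : StandardSubspace H where
  toClosedSubmodule := V.toClosedSubmodule.mapEquiv e
  IsSeparating := by
    rw [mulI_mapEquiv e he, ← ClosedSubmodule.mapEquiv_inf_eq, V.IsSeparating,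
      ClosedSubmodule.mapEquiv_bot_eq_bot]
  IsCyclic := by
    rw [mulI_mapEquiv e he, ← ClosedSubmodule.mapEquiv_sup_eq, V.IsCyclic,
      ClosedSubmodule.mapEquiv_top_eq_top]

/-- The image `gV` of a standard subspace under a unitary operator. -/
def unitaryImage (g : H ≃ₗᵢ[ℂ] H) (V : StandardSubspace H) : StandardSubspace H :=
  V.image (g.toContinuousLinearEquiv.restrictScalars ℝ) (Or.inl fun x => g.map_smul Complex.I x)

/-- The image `JV` of a standard subspace under a conjugation. -/
def conjImage (J : Conjugation H) (V : StandardSubspace H) : StandardSubspace H :=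
  V.image J.toRealCLE (Or.inr fun x => by
    have h : J.toEquiv (Complex.I • x) = -(Complex.I • J.toEquiv x) := by
      simpa using J.toEquiv.map_smulₛₗ Complex.I x
    exact h)

lemma mem_unitaryImage (g : H ≃ₗᵢ[ℂ] H) (V : StandardSubspace H) (x : H) :
    x ∈ (V.unitaryImage g).toClosedSubmodule ↔ g.symm x ∈ V.toClosedSubmodule :=
  ClosedSubmodule.mem_mapEquiv_iff _ _ _

lemma mem_conjImage (J : Conjugation H) (V : StandardSubspace H) (x : H) :
    x ∈ (V.conjImage J).toClosedSubmodule ↔ J.toEquiv x ∈ V.toClosedSubmodule :=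
  ClosedSubmodule.mem_mapEquiv_iff _ _ _

lemma eq_of_mem_iff {V W : StandardSubspace H}
    (h : ∀ x, x ∈ V.toClosedSubmodule ↔ x ∈ W.toClosedSubmodule) : V = W :=
  StandardSubspace.ext (SetLike.ext h)

/-- The action `(g, V) ↦ gV` of the unitary group on the set of standard subspaces. -/
instance instUnitaryAction : MulAction (H ≃ₗᵢ[ℂ] H) (StandardSubspace H) where
  smul g V := V.unitaryImage g
  one_smul V := eq_of_mem_iff fun x => mem_unitaryImage 1 V x
  mul_smul g h V := eq_of_mem_iff fun x =>
    (mem_unitaryImage (g * h) V x).trans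
      ((mem_unitaryImage g (V.unitaryImage h) x).trans (mem_unitaryImage h V (g.symm x))).symm

lemma mem_smul_iff (g : H ≃ₗᵢ[ℂ] H) (V : StandardSubspace H) (x : H) :
    x ∈ (g • V).toClosedSubmodule ↔ g.symm x ∈ V.toClosedSubmodule :=
  mem_unitaryImage g V x

variable (V : StandardSubspace H)

lemma eq_zero_of_mem {x : H} (hx : x ∈ V.toClosedSubmodule)
    (hIx : Complex.I • x ∈ V.toClosedSubmodule) : x = 0 := by
  have h : x ∈ V.toClosedSubmodule ⊓ V.toClosedSubmodule.mulI :=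
    ClosedSubmodule.mem_inf.2 ⟨hx, (mem_mulI_iff _ _).2 hIx⟩
  rw [V.IsSeparating] at h
  simpa using h

/-- The decomposition `x = v + i w` with `v, w ∈ V` is unique. -/
lemma decomp_unique {v w v' w' : H} (hv : v ∈ V.toClosedSubmodule) (hw : w ∈ V.toClosedSubmodule)
    (hv' : v' ∈ V.toClosedSubmodule) (hw' : w' ∈ V.toClosedSubmodule)
    (h : v + Complex.I • w = v' + Complex.I • w') : v = v' ∧ w = w' := by
  have h2 : Complex.I • (w - w') = v' - v := by
    rw [smul_sub, sub_eq_sub_iff_add_eq_add, add_comm, h, add_comm]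
  have h1 : w - w' = 0 := by
    refine V.eq_zero_of_mem (sub_mem' _ hw hw') ?_
    rw [h2]
    exact sub_mem' _ hv' hv
  have h3 : w = w' := sub_eq_zero.1 h1
  subst h3
  exact ⟨add_right_cancel h, rfl⟩

/-- The complex subspace `V + iV`. -/
def complexSpan : Submodule ℂ H where
  carrier := {x | ∃ v ∈ V.toClosedSubmodule, ∃ w ∈ V.toClosedSubmodule, x = v + Complex.I • w}
  zero_mem' := ⟨0, zero_mem _, 0, zero_mem _, by simp⟩
  add_mem' := by
    rintro _ _ ⟨v, hv, w, hw, rfl⟩ ⟨v', hv', w', hw', rfl⟩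
    exact ⟨v + v', add_mem hv hv', w + w', add_mem hw hw', by rw [smul_add]; abel⟩
  smul_mem' := by
    rintro c _ ⟨v, hv, w, hw, rfl⟩
    refine ⟨c.re • v - c.im • w, sub_mem' _ (SMulMemClass.smul_mem _ hv)
      (SMulMemClass.smul_mem _ hw), c.re • w + c.im • v,
      add_mem (SMulMemClass.smul_mem _ hw) (SMulMemClass.smul_mem _ hv), ?_⟩
    simp only [← Complex.coe_smul]
    match_scalars <;> apply Complex.ext <;> simp

/-- `V`-components of an element `v + i w` of `V + iV`. -/
def rePart (x : V.complexSpan) : H := x.2.choose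

def imPart (x : V.complexSpan) : H := x.2.choose_spec.2.choose

lemma rePart_mem (x : V.complexSpan) : V.rePart x ∈ V.toClosedSubmodule := x.2.choose_spec.1

lemma imPart_mem (x : V.complexSpan) : V.imPart x ∈ V.toClosedSubmodule :=
  x.2.choose_spec.2.choose_spec.1

lemma rePart_add_imPart (x : V.complexSpan) : (x : H) = V.rePart x + Complex.I • V.imPart x :=
  x.2.choose_spec.2.choose_spec.2

lemma parts_eq (x : V.complexSpan) {v w : H} (hv : v ∈ V.toClosedSubmodule)
    (hw : w ∈ V.toClosedSubmodule) (h : (x : H) = v + Complex.I • w) :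
    V.rePart x = v ∧ V.imPart x = w :=
  V.decomp_unique (V.rePart_mem x) (V.imPart_mem x) hv hw ((V.rePart_add_imPart x).symm.trans h)

/-- The Tomita operator: the unbounded antilinear operator `S` with domain `V + iV` and
`S(v + i w) = v - i w` for `v, w ∈ V`. -/
def tomita : H →ₛₗ.[starRingEnd ℂ] H where
  domain := V.complexSpan
  toFun :=
    { toFun := fun x => V.rePart x - Complex.I • V.imPart x
      map_add' := fun x y => by
        obtain ⟨h1, h2⟩ := V.parts_eq (x + y) (v := V.rePart x + V.rePart y)
          (w := V.imPart x + V.imPart y) (add_mem (V.rePart_mem x) (V.rePart_mem y))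
          (add_mem (V.imPart_mem x) (V.imPart_mem y)) (by
            rw [Submodule.coe_add, V.rePart_add_imPart x, V.rePart_add_imPart y]; module)
        rw [h1, h2]
        module
      map_smul' := fun c x => by
        obtain ⟨h1, h2⟩ := V.parts_eq (c • x) (v := c.re • V.rePart x - c.im • V.imPart x)
          (w := c.re • V.imPart x + c.im • V.rePart x)
          (sub_mem' _ (SMulMemClass.smul_mem _ (V.rePart_mem x))
            (SMulMemClass.smul_mem _ (V.imPart_mem x)))
          (add_mem (SMulMemClass.smul_mem _ (V.imPart_mem x))
            (SMulMemClass.smul_mem _ (V.rePart_mem x))) (by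
            rw [Submodule.coe_smul, V.rePart_add_imPart x]
            simp only [← Complex.coe_smul]
            match_scalars <;> apply Complex.ext <;> simp)
        rw [h1, h2]
        simp only [← Complex.coe_smul]
        match_scalars <;> apply Complex.ext <;> simp }

/-- The Tomita operator is given by the expected formula. -/
lemma tomita_apply (x : V.tomita.domain) {v w : H} (hv : v ∈ V.toClosedSubmodule)
    (hw : w ∈ V.toClosedSubmodule) (h : (x : H) = v + Complex.I • w) :
    V.tomita x = v - Complex.I • w := by
  obtain ⟨h1, h2⟩ := V.parts_eq x hv hw h
  change V.rePart x - Complex.I • V.imPart x = _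
  rw [h1, h2]

/-- `(x, y)` belongs to the graph of the modular operator `Δ = S* S`: here `x` is in the domain of
`S`, and `y = S* (S x)`. The adjoint of the antilinear operator `S` is characterized by
`⟪S* u, z⟫ = ⟪S z, u⟫` for all `z` in the domain of `S`. -/
def IsModularValue (x y : H) : Prop :=
  ∃ hx : x ∈ V.tomita.domain, ∀ z : V.tomita.domain,
    inner ℂ y (z : H) = inner ℂ (V.tomita z) (V.tomita ⟨x, hx⟩)

/-- `D` is the operator `Δ^{1/2}`: a positive selfadjoint operator whose square (on its natural
domain) is `Δ = S* S`. -/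
structure IsModularSqrt [CompleteSpace H] (D : H →ₗ.[ℂ] H) : Prop where
  selfAdjoint : IsSelfAdjoint D
  nonneg : ∀ x : D.domain, 0 ≤ (inner ℂ (x : H) (D x)).re
  sq : ∀ x y : H, (∃ hx : x ∈ D.domain, ∃ hDx : D ⟨x, hx⟩ ∈ D.domain, D ⟨D ⟨x, hx⟩, hDx⟩ = y) ↔
    V.IsModularValue x y

/-- `J` is the conjugation in the polar decomposition `S = J Δ^{1/2}` (an equality of unbounded
operators, including the domains). -/
def IsModularConjugation [CompleteSpace H] (J : Conjugation H) : Prop :=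
  ∃ D : H →ₗ.[ℂ] H, V.IsModularSqrt D ∧
    V.tomita = (J.toEquiv.toLinearEquiv : H →ₛₗ[starRingEnd ℂ] H).compPMap D

open Classical in
/-- The modular conjugation `J_V`. That it is determined by the polar decomposition of `S` (so
that the value in the second case plays no role) is asserted in the theorem. -/
def modularConj [CompleteSpace H] : Conjugation H :=
  if h : ∃ J, V.IsModularConjugation J then h.choose else Classical.choice inferInstance

/-- The product `V • W = J_V J_W W` of the reflection space of standard subspaces. -/
def reflect [CompleteSpace H] (V W : StandardSubspace H) : StandardSubspace H :=
  (W.conjImage W.modularConj).conjImage V.modularConj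

/-- The fibre of `V ↦ J_V` over `J`. -/
def fibre [CompleteSpace H] (J : Conjugation H) : Set (StandardSubspace H) :=
  {V | V.modularConj = J}

/-! ### The associated bundle and its reflection structure -/

/-- The orbit relation on `U(H) × Stand_J(H)` of the action `h.(g, V) = (g h⁻¹, hV)` of the group
`O(H^J) = U(H)^τ`. That this group leaves the fibre invariant is asserted in the theorem; the
relation below makes sense without this. -/
def loosSetoid [CompleteSpace H] (J : Conjugation H) :
    Setoid ((H ≃ₗᵢ[ℂ] H) × fibre J) where
  r p q := ∃ h ∈ J.fixedUnitary,
    q.1 = p.1 * h⁻¹ ∧ (q.2 : StandardSubspace H) = h • (p.2 : StandardSubspace H)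
  iseqv :=
    { refl := fun p => ⟨1, one_mem _, by simp, by simp⟩
      symm := by
        rintro p q ⟨h, hh, h1, h2⟩
        exact ⟨h⁻¹, inv_mem hh, by simp [h1], by simp [h2]⟩
      trans := by
        rintro p q r ⟨h, hh, h1, h2⟩ ⟨k, hk, h3, h4⟩
        exact ⟨k * h, mul_mem hk hh, by simp [h1, h3, mul_assoc], by simp [h2, h4, mul_smul]⟩ }

/-- `U(H) ×_{O(H^J)} Stand_J(H)`. -/
def LoosBundle [CompleteSpace H] (J : Conjugation H) : Type _ := Quotient (loosSetoid J)

namespace LoosBundle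

variable [CompleteSpace H] {J : Conjugation H}

/-- The class `[g, V]`. -/
def mk (g : H ≃ₗᵢ[ℂ] H) (V : fibre J) : LoosBundle J := Quotient.mk (loosSetoid J) (g, V)

/-- The product `[g₁, V₁] • [g₂, V₂] = [g₁ τ(g₁⁻¹ g₂), V₂]`. -/
def reflect : LoosBundle J → LoosBundle J → LoosBundle J :=
  Quotient.map₂ (fun p q => (p.1 * J.tau (p.1⁻¹ * q.1), q.2)) (by
    rintro ⟨g, V⟩ ⟨g', V'⟩ ⟨h, hh, h1, -⟩ ⟨k, W⟩ ⟨k', W'⟩ ⟨l, hl, h3, h4⟩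
    dsimp only at h1 h3 h4
    refine ⟨l, hl, ?_, h4⟩
    have h5 : J.tau h = h := hh
    have h6 : J.tau l = l := hl
    simp [h1, h3, h5, h6, mul_assoc])

/-- The action `g.[g', V] = [g g', V]` of the unitary group. -/
def translate (g : H ≃ₗᵢ[ℂ] H) : LoosBundle J → LoosBundle J :=
  Quotient.map (fun p => (g * p.1, p.2)) (by
    rintro p q ⟨h, hh, h1, h2⟩
    exact ⟨h, hh, by simp [h1, mul_assoc], h2⟩)

/-- The map `[g, V] ↦ gV`. -/
def toStand : LoosBundle J → StandardSubspace H :=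
  Quotient.lift (fun p => p.1 • (p.2 : StandardSubspace H)) (by
    rintro p q ⟨h, hh, h1, h2⟩
    simp [h1, h2, smul_smul])

lemma reflect_mk (g₁ g₂ : H ≃ₗᵢ[ℂ] H) (V₁ V₂ : fibre J) :
    reflect (mk g₁ V₁) (mk g₂ V₂) = mk (g₁ * J.tau (g₁⁻¹ * g₂)) V₂ := rfl

lemma translate_mk (g g' : H ≃ₗᵢ[ℂ] H) (V : fibre J) :
    translate g (mk g' V) = mk (g * g') V := rfl

lemma toStand_mk (g : H ≃ₗᵢ[ℂ] H) (V : fibre J) :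
    toStand (mk g V) = g • (V : StandardSubspace H) := rfl

end LoosBundle

end StandardSubspace

end

/-!
Every unbounded operator is replaced by bounded ones built from two real orthogonal projections,
`P` onto `V` and `Q = i P i⁻¹` onto `iV`. The operator `B = (P + Q) / 2` is complex linear with
`0 ≤ B ≤ 1`, the operator `P - Q` is antilinear, and
`(P - Q)² = 4 B (1 - B)`, `(P - Q) B = (1 - B) (P - Q)`. Cyclicity and separation of `V` say that
`B` and `1 - B` are injective, so `P - Q` has dense range and a unique polar decomposition with an
antiunitary part (`IsPolarConjugation`, `IsPolarConjugation.unique`).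

*Modular conjugation.* A direct computation gives `B = (1 + Δ)⁻¹` (`isModularValue_resolvent`) and
`2 S B = P - Q` (`tomita_resolvent`). Hence `S = J Δ^{1/2}` implies
`J (P - Q) = 2 Δ^{1/2} (1 + Δ)⁻¹ ≥ 0`, so that `J` is the antiunitary part of `P - Q`
(`IsModularConjugation.isPolarConjugation`), which is the uniqueness. For the existence let
`c = B^{1/2}` and `s = (1 - B)^{1/2}`. Then `c² + s² = 1`, the operator `s c⁻¹` is positive and
selfadjoint (`isSelfAdjoint_divPMap`), `P - Q = 2 J c s` for a conjugation `J`, and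
`S = J s c⁻¹` (`exists_isModularConjugation`).

*Covariance.* The description by `P - Q` makes `J_{gV} = g J_V g⁻¹` for unitary `g` and
`J_{LV} = L J_V L` for conjugations `L` evident (`modularConj_smul`, `modularConj_conjImage`). From
these follow the axioms for `V • W = J_V J_W W`, the triviality of the product on the fibre, and
the fact that `[g, V] ↦ gV` is an injective morphism; the axioms for the bundle are pulled back
along it.

*Surjectivity.* By covariance it is enough that any two conjugations `J`, `K` are conjugate under
the unitary group (`Conjugation.exists_unitaryConj_eq`). The normal operator `A = 1 + K J`
intertwines `J` and `K`, and so does its unitary polar part on `(ker A)ᗮ`; on `ker A` one has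
`K = -J` and multiplication by `i` does.

*The group `U(H)^τ`.* Since `H = H^J + i H^J` with `‖p + i q‖² = ‖p‖² + ‖q‖²` for `p, q ∈ H^J`, each
orthogonal transformation of `H^J` has exactly one complex linear extension
(`Conjugation.restrict_bijective`).
-/

/-! ### Bounded operators: square roots, injectivity and antiunitary maps -/

section OperatorLemmas

variable {H : Type*} [NormedAddCommGroup H] [InnerProductSpace ℂ H]

/-- A complex linear operator that is symmetric for the real part of the inner product is
symmetric. -/
lemma inner_map_eq_of_re {T : H →L[ℂ] H}
    (h : ∀ x y, (inner ℂ (T x) y).re = (inner ℂ x (T y)).re) (x y : H) :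
    inner ℂ (T x) y = inner ℂ x (T y) := by
  apply Complex.ext (h x y)
  have h1 := h x (Complex.I • y)
  simpa [map_smul, inner_smul_right] using h1

/-- An antiunitary map conjugates inner products. -/
lemma inner_antiunitary_map (L : H ≃ₗᵢ⋆[ℂ] H) (x y : H) :
    inner ℂ (L x) (L y) = inner ℂ y x := by
  have hre : ∀ x y : H, (inner ℂ (L x) (L y)).re = (inner ℂ x y).re := by
    intro x y
    have h1 := norm_add_sq (𝕜 := ℂ) (L x) (L y)
    have h2 := norm_add_sq (𝕜 := ℂ) x y
    rw [← map_add, L.norm_map, L.norm_map, L.norm_map] at h1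
    simp only [RCLike.re_to_complex] at h1 h2
    linarith
  have hsymm : (inner ℂ y x : ℂ) = starRingEnd ℂ (inner ℂ x y) := (inner_conj_symm y x).symm
  rw [hsymm]
  apply Complex.ext
  · rw [Complex.conj_re, hre]
  · have h1 := hre x (Complex.I • y)
    rw [L.map_smulₛₗ] at h1
    rw [Complex.conj_im]
    simpa [inner_smul_right] using h1

lemma Conjugation.apply_apply (J : Conjugation H) (x : H) : J.toEquiv (J.toEquiv x) = x :=
  J.involutive x

lemma Conjugation.symm_toEquiv (J : Conjugation H) : J.toEquiv.symm = J.toEquiv := by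
  ext x
  rw [LinearIsometryEquiv.symm_apply_eq, J.apply_apply]

lemma Conjugation.ext_of_apply {J K : Conjugation H} (h : ∀ x, J.toEquiv x = K.toEquiv x) :
    J = K := by
  cases J
  cases K
  congr
  ext x
  exact h x

/-- Transport `T ↦ L T L⁻¹` of a bounded operator by an antiunitary map `L`. -/
noncomputable def antiConj (L : H ≃ₗᵢ⋆[ℂ] H) (T : H →L[ℂ] H) : H →L[ℂ] H :=
  (L : H →L⋆[ℂ] H).comp (T.comp (L.symm : H →L⋆[ℂ] H))

@[simp]
lemma antiConj_apply (L : H ≃ₗᵢ⋆[ℂ] H) (T : H →L[ℂ] H) (x : H) :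
    antiConj L T x = L (T (L.symm x)) := rfl

lemma antiConj_mul (L : H ≃ₗᵢ⋆[ℂ] H) (S T : H →L[ℂ] H) :
    antiConj L (S * T) = antiConj L S * antiConj L T := by
  ext x
  simp

lemma inner_map_of_nonneg {T : H →L[ℂ] H} (hT : 0 ≤ T) (x y : H) :
    inner ℂ (T x) y = inner ℂ x (T y) :=
  ((ContinuousLinearMap.nonneg_iff_isPositive T).1 hT).isSymmetric x y

lemma nonneg_of_re {T : H →L[ℂ] H}
    (h : ∀ x y, (inner ℂ (T x) y).re = (inner ℂ x (T y)).re)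
    (h' : ∀ x, 0 ≤ (inner ℂ (T x) x).re) : 0 ≤ T := by
  rw [ContinuousLinearMap.nonneg_iff_isPositive, ContinuousLinearMap.isPositive_def]
  exact ⟨fun x y => inner_map_eq_of_re h x y, h'⟩

lemma re_inner_map_self_nonneg {T : H →L[ℂ] H} (hT : 0 ≤ T) (x : H) :
    0 ≤ (inner ℂ (T x) x).re :=
  ((ContinuousLinearMap.nonneg_iff_isPositive T).1 hT).re_inner_nonneg_left x

lemma antiConj_nonneg (L : H ≃ₗᵢ⋆[ℂ] H) {T : H →L[ℂ] H} (hT : 0 ≤ T) : 0 ≤ antiConj L T := by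
  have key : ∀ x y, inner ℂ (antiConj L T x) y = inner ℂ (L.symm y) (T (L.symm x)) := by
    intro x y
    rw [antiConj_apply]
    conv_lhs => rw [← L.apply_symm_apply y]
    rw [inner_antiunitary_map]
  apply nonneg_of_re
  · intro x y
    rw [key, ← inner_conj_symm x, key, Complex.conj_re, ← inner_map_of_nonneg hT,
      ← inner_conj_symm, Complex.conj_re]
  · intro x
    rw [key, ← inner_map_of_nonneg hT]
    exact re_inner_map_self_nonneg hT _

lemma norm_sq_of_nonneg {T : H →L[ℂ] H} (hT : 0 ≤ T) (x : H) :
    ‖T x‖ ^ 2 = (inner ℂ ((T * T) x) x).re := by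
  rw [mul_apply_eq_comp, inner_map_of_nonneg hT, ← RCLike.re_to_complex,
    inner_self_eq_norm_sq]

variable [CompleteSpace H]

lemma eq_of_mul_self_eq {S T : H →L[ℂ] H} (hS : 0 ≤ S) (hT : 0 ≤ T) (h : S * S = T * T) :
    S = T := by
  rw [← CFC.sqrt_mul_self S hS, h, CFC.sqrt_mul_self T hT]

lemma denseRange_of_inner_eq_zero {σ : ℂ →+* ℂ} [RingHomSurjective σ] {T : H →SL[σ] H}
    (h : ∀ y, (∀ x, inner ℂ (T x) y = 0) → y = 0) : DenseRange T := by
  have h1 : (T.range).topologicalClosure = ⊤ := by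
    rw [Submodule.topologicalClosure_eq_top_iff, Submodule.eq_bot_iff]
    exact fun y hy => h y fun x => hy _ ⟨x, rfl⟩
  have h2 := Submodule.dense_iff_topologicalClosure_eq_top.2 h1
  exact h2

lemma denseRange_of_nonneg {T : H →L[ℂ] H} (hT : 0 ≤ T) (h0 : ∀ x, T x = 0 → x = 0) :
    DenseRange T :=
  denseRange_of_inner_eq_zero fun y hy => h0 y <| by
    rw [← inner_self_eq_zero (𝕜 := ℂ), ← inner_map_of_nonneg hT, hy]

lemma commute_sqrt {S T : H →L[ℂ] H} (h : Commute S T) : Commute (CFC.sqrt S) T := by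
  exact h.cfcₙ_nnreal _

/-- Two bounded operators with the same norms and dense ranges differ by a unitary operator. -/
lemma exists_unitary_of_norm_eq {M N : H →L[ℂ] H} (h : ∀ x, ‖N x‖ = ‖M x‖)
    (hM : DenseRange M) (hN : DenseRange N) :
    ∃ g : H ≃ₗᵢ[ℂ] H, ∀ x, g (M x) = N x :=
  ⟨(LinearEquiv.refl ℂ H).extendOfIsometry (M : H →ₗ[ℂ] H) (N : H →ₗ[ℂ] H) hM hN h,
    fun x => LinearEquiv.extendOfIsometry_eq (f := LinearEquiv.refl ℂ H)
      (e₁ := (M : H →ₗ[ℂ] H)) (e₂ := (N : H →ₗ[ℂ] H)) hM hN h x⟩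

/-- A linear and an antilinear bounded operator with the same norms and dense ranges differ by an
antiunitary operator. -/
lemma exists_antiunitary_of_norm_eq {M : H →L[ℂ] H} {N : H →L⋆[ℂ] H} (h : ∀ x, ‖N x‖ = ‖M x‖)
    (hM : DenseRange M) (hN : DenseRange N) :
    ∃ L : H ≃ₗᵢ⋆[ℂ] H, ∀ x, L (M x) = N x := by
  -- An auxiliary conjugation turns the antilinear operator into a linear one.
  obtain ⟨K⟩ : Nonempty (Conjugation H) := inferInstance
  let N' : H →L[ℂ] H := N.comp (K.toEquiv : H →L⋆[ℂ] H)
  have hN' : DenseRange N' := hN.comp K.toEquiv.surjective.denseRange N.continuous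
  have h1 : ∀ x, N' (K.toEquiv x) = N x := fun x => congrArg N (K.involutive x)
  have h2 : ∀ x, ‖N' (K.toEquiv x)‖ = ‖M x‖ := fun x => by rw [h1, h]
  exact ⟨K.toEquiv.toLinearEquiv.extendOfIsometry (M : H →ₗ[ℂ] H) (N' : H →ₗ[ℂ] H) hM hN' h2,
    fun x => (LinearEquiv.extendOfIsometry_eq (f := K.toEquiv.toLinearEquiv)
      (e₁ := (M : H →ₗ[ℂ] H)) (e₂ := (N' : H →ₗ[ℂ] H)) hM hN' h2 x).trans (h1 x)⟩

end OperatorLemmas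

/-! ### The projections onto `V` and `iV` -/

namespace StandardSubspace

section Projections

-- the real inner product `re ⟪x, y⟫` on `H` is a scoped instance of this namespace
open ClosedSubmodule

variable {H : Type*} [NormedAddCommGroup H] [InnerProductSpace ℂ H] [CompleteSpace H]
  (V : StandardSubspace H)

instance : V.toClosedSubmodule.toSubmodule.HasOrthogonalProjection :=
  haveI : CompleteSpace V.toClosedSubmodule.toSubmodule :=
    V.toClosedSubmodule.isClosed.completeSpace_coe
  inferInstance

/-- The real orthogonal projection `P` onto the closed real subspace `V`. -/
noncomputable def proj : H →L[ℝ] H := V.toClosedSubmodule.toSubmodule.starProjection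

lemma proj_mem (x : H) : V.proj x ∈ V.toClosedSubmodule :=
  V.toClosedSubmodule.toSubmodule.starProjection_apply_mem x

lemma proj_eq_self_iff {x : H} : V.proj x = x ↔ x ∈ V.toClosedSubmodule :=
  Submodule.starProjection_eq_self_iff

@[simp]
lemma proj_proj (x : H) : V.proj (V.proj x) = V.proj x := V.proj_eq_self_iff.2 (V.proj_mem x)

lemma re_inner_proj (x y : H) : (inner ℂ (V.proj x) y).re = (inner ℂ x (V.proj y)).re :=
  V.toClosedSubmodule.toSubmodule.starProjection_isSymmetric x y

lemma proj_eq_of_mem {x y : H} (hy : y ∈ V.toClosedSubmodule)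
    (h : ∀ v ∈ V.toClosedSubmodule, (inner ℂ (x - y) v).re = 0) : V.proj x = y :=
  Submodule.eq_starProjection_of_mem_of_inner_eq_zero hy h

/-- The real orthogonal projection `Q = i P i⁻¹` onto `iV`. -/
noncomputable def projI (x : H) : H := -(Complex.I • V.proj (Complex.I • x))

lemma projI_add (x y : H) : V.projI (x + y) = V.projI x + V.projI y := by
  simp only [projI, smul_add, map_add]
  abel

lemma continuous_projI : Continuous V.projI := by
  unfold projI
  fun_prop

lemma proj_I_smul (x : H) : V.proj (Complex.I • x) = Complex.I • V.projI x := by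
  simp [projI, smul_smul]

lemma projI_I_smul (x : H) : V.projI (Complex.I • x) = Complex.I • V.proj x := by
  simp [projI, smul_smul]

@[simp]
lemma projI_projI (x : H) : V.projI (V.projI x) = V.projI x := by
  simp [projI, smul_smul]

lemma re_inner_projI (x y : H) : (inner ℂ (V.projI x) y).re = (inner ℂ x (V.projI y)).re := by
  have h := V.re_inner_proj (Complex.I • x) (Complex.I • y)
  simp only [inner_smul_right, inner_smul_left] at h
  simp [projI, inner_smul_right, inner_smul_left] at h ⊢
  linarith

lemma proj_smul (c : ℂ) (x : H) :
    V.proj (c • x) = (c.re : ℂ) • V.proj x + (c.im : ℂ) • (Complex.I • V.projI x) := by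
  have h : c • x = c.re • x + c.im • (Complex.I • x) := by
    rw [← Complex.coe_smul, ← Complex.coe_smul, smul_smul, ← add_smul, Complex.re_add_im]
  rw [h, map_add, map_smul, map_smul, proj_I_smul, Complex.coe_smul,
      Complex.coe_smul]

lemma projI_smul (c : ℂ) (x : H) :
    V.projI (c • x) = (c.re : ℂ) • V.projI x + (c.im : ℂ) • (Complex.I • V.proj x) := by
  have h := V.proj_smul c (Complex.I • x)
  rw [smul_comm c, proj_I_smul, proj_I_smul, projI_I_smul] at h
  apply smul_right_injective H Complex.I_ne_zero
  simp only
  rw [h, smul_add, smul_comm Complex.I (c.re : ℂ), smul_comm Complex.I (c.im : ℂ)]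

/-- The bounded complex linear operator `B = (P + Q) / 2`, which is `(1 + Δ)⁻¹`. -/
noncomputable def resolvent : H →L[ℂ] H where
  toFun x := (1 / 2 : ℂ) • (V.proj x + V.projI x)
  map_add' x y := by
    rw [map_add, projI_add]
    module
  map_smul' c x := by
    rw [proj_smul, projI_smul, RingHom.id_apply]
    conv_rhs => rw [← Complex.re_add_im c]
    module
  cont := (V.proj.continuous.add V.continuous_projI).const_smul _

/-- The bounded antilinear operator `P - Q`. It is `2 S (1 + Δ)⁻¹`. -/
noncomputable def diff : H →L⋆[ℂ] H where
  toFun x := V.proj x - V.projI x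
  map_add' x y := by
    rw [map_add, projI_add]
    abel
  map_smul' c x := by
    have hc : starRingEnd ℂ c = c.re - c.im * Complex.I := by
      apply Complex.ext <;> simp
    rw [proj_smul, projI_smul, hc]
    module
  cont := V.proj.continuous.sub V.continuous_projI

lemma resolvent_apply (x : H) : V.resolvent x = (1 / 2 : ℂ) • (V.proj x + V.projI x) := rfl

lemma diff_apply (x : H) : V.diff x = V.proj x - V.projI x := rfl

lemma proj_smul_half (x : H) : V.proj ((1 / 2 : ℂ) • x) = (1 / 2 : ℂ) • V.proj x := by
  have h := V.proj_smul (1 / 2) x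
  simpa using h

lemma projI_smul_half (x : H) : V.projI ((1 / 2 : ℂ) • x) = (1 / 2 : ℂ) • V.projI x := by
  have h := V.projI_smul (1 / 2) x
  simpa using h

lemma diff_resolvent (x : H) : V.diff (V.resolvent x) = V.diff x - V.resolvent (V.diff x) := by
  simp only [diff_apply, resolvent_apply, proj_smul_half, projI_smul_half, map_add, map_sub,
    projI_add, proj_proj, projI_projI]
  module

lemma diff_diff (x : H) :
    V.diff (V.diff x) = (4 : ℂ) • (V.resolvent x - V.resolvent (V.resolvent x)) := by
  simp only [diff_apply, resolvent_apply, proj_smul_half, projI_smul_half, map_add, map_sub,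
    projI_add, proj_proj, projI_projI]
  module

lemma re_inner_diff (x y : H) : (inner ℂ (V.diff x) y).re = (inner ℂ x (V.diff y)).re := by
  rw [diff_apply, diff_apply, inner_sub_left, inner_sub_right, Complex.sub_re, Complex.sub_re,
    re_inner_proj, re_inner_projI]

lemma re_inner_resolvent (x y : H) :
    (inner ℂ (V.resolvent x) y).re = (inner ℂ x (V.resolvent y)).re := by
  have h1 := V.re_inner_proj x y
  have h2 := V.re_inner_projI x y
  simp [resolvent_apply]
  linarith

lemma inner_diff (x y : H) : inner ℂ (V.diff x) y = inner ℂ (V.diff y) x := by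
  have hre : ∀ x y, (inner ℂ (V.diff x) y).re = (inner ℂ (V.diff y) x).re := fun x y => by
    rw [re_inner_diff, ← inner_conj_symm, Complex.conj_re]
  apply Complex.ext (hre x y)
  have h := hre x (Complex.I • y)
  rw [V.diff.map_smulₛₗ] at h
  simpa [inner_smul_left, inner_smul_right] using h

lemma re_inner_proj_self (x : H) : (inner ℂ (V.proj x) x).re = ‖V.proj x‖ ^ 2 := by
  rw [← V.proj_proj x, re_inner_proj, proj_proj, ← RCLike.re_to_complex, inner_self_eq_norm_sq]

lemma re_inner_projI_self (x : H) : (inner ℂ (V.projI x) x).re = ‖V.projI x‖ ^ 2 := by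
  rw [← V.projI_projI x, re_inner_projI, projI_projI, ← RCLike.re_to_complex,
    inner_self_eq_norm_sq]

lemma re_inner_resolvent_self (x : H) :
    (inner ℂ (V.resolvent x) x).re = (‖V.proj x‖ ^ 2 + ‖V.projI x‖ ^ 2) / 2 := by
  rw [← re_inner_proj_self, ← re_inner_projI_self]
  simp [resolvent_apply]
  ring

lemma norm_sub_proj_sq (x : H) : ‖x - V.proj x‖ ^ 2 = ‖x‖ ^ 2 - ‖V.proj x‖ ^ 2 := by
  have h := V.re_inner_proj_self x
  rw [← inner_conj_symm, Complex.conj_re] at h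
  rw [norm_sub_sq (𝕜 := ℂ), RCLike.re_to_complex, h]
  ring

lemma norm_sub_projI_sq (x : H) : ‖x - V.projI x‖ ^ 2 = ‖x‖ ^ 2 - ‖V.projI x‖ ^ 2 := by
  have h := V.re_inner_projI_self x
  rw [← inner_conj_symm, Complex.conj_re] at h
  rw [norm_sub_sq (𝕜 := ℂ), RCLike.re_to_complex, h]
  ring

lemma re_inner_sub_resolvent_self (x : H) :
    (inner ℂ (x - V.resolvent x) x).re = (‖x - V.proj x‖ ^ 2 + ‖x - V.projI x‖ ^ 2) / 2 := by
  rw [norm_sub_proj_sq, norm_sub_projI_sq, inner_sub_left, Complex.sub_re,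
    re_inner_resolvent_self, ← RCLike.re_to_complex, inner_self_eq_norm_sq]
  ring

lemma resolvent_nonneg : 0 ≤ V.resolvent :=
  nonneg_of_re V.re_inner_resolvent fun x => by
    rw [re_inner_resolvent_self]
    positivity

lemma one_sub_resolvent_nonneg : 0 ≤ 1 - V.resolvent := by
  apply nonneg_of_re
  · intro x y
    have h := V.re_inner_resolvent x y
    simp [h]
  · intro x
    have h := V.re_inner_sub_resolvent_self x
    rw [sub_apply, one_apply_eq_self, h]
    positivity

/-- Cyclicity of `V` makes `P + Q` injective. -/
lemma resolvent_injective {x : H} (h : V.resolvent x = 0) : x = 0 := by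
  have h1 := V.re_inner_resolvent_self x
  rw [h, inner_zero_left, Complex.zero_re] at h1
  have h2 : V.proj x = 0 := by
    rw [← norm_eq_zero, ← sq_eq_zero_iff]
    nlinarith [sq_nonneg ‖V.proj x‖, sq_nonneg ‖V.projI x‖]
  have h3 : V.projI x = 0 := by
    rw [← norm_eq_zero, ← sq_eq_zero_iff]
    nlinarith [sq_nonneg ‖V.proj x‖, sq_nonneg ‖V.projI x‖]
  have h4 : x ∈ (V.toClosedSubmodule ⊔ V.toClosedSubmodule.mulI)ᗮ := by
    rw [← ClosedSubmodule.inf_orthogonal, ClosedSubmodule.mem_inf]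
    constructor
    · rw [ClosedSubmodule.mem_orthogonal]
      intro v hv
      have h5 := V.re_inner_proj v x
      rw [h2, inner_zero_right, V.proj_eq_self_iff.2 hv] at h5
      exact h5
    · rw [ClosedSubmodule.mem_orthogonal]
      intro v hv
      rw [StandardSubspace.mem_mulI_iff] at hv
      have h5 := V.re_inner_projI v x
      rw [h3, inner_zero_right, projI, V.proj_eq_self_iff.2 hv] at h5
      rw [inner_real_eq_re_inner]
      simpa [smul_smul] using h5
  rw [V.IsCyclic] at h4
  rw [ClosedSubmodule.mem_orthogonal] at h4
  have h6 := h4 x ClosedSubmodule.mem_top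
  exact (inner_self_eq_zero (𝕜 := ℝ)).1 h6

/-- Separation of `V` makes `2 - (P + Q)` injective. -/
lemma sub_resolvent_injective {x : H} (h : x - V.resolvent x = 0) : x = 0 := by
  have h1 := V.re_inner_sub_resolvent_self x
  rw [h, inner_zero_left, Complex.zero_re] at h1
  have h2 : x - V.proj x = 0 := by
    rw [← norm_eq_zero, ← sq_eq_zero_iff]
    nlinarith [sq_nonneg ‖x - V.proj x‖, sq_nonneg ‖x - V.projI x‖]
  have h3 : x - V.projI x = 0 := by
    rw [← norm_eq_zero, ← sq_eq_zero_iff]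
    nlinarith [sq_nonneg ‖x - V.proj x‖, sq_nonneg ‖x - V.projI x‖]
  refine V.eq_zero_of_mem (V.proj_eq_self_iff.1 (sub_eq_zero.1 h2).symm) ?_
  rw [← V.proj_eq_self_iff, proj_I_smul, (sub_eq_zero.1 h3).symm]

lemma diff_injective {x : H} (h : V.diff x = 0) : x = 0 := by
  have h1 := V.diff_diff x
  rw [h, map_zero, ← map_sub, eq_comm, smul_eq_zero_iff_right (by norm_num)] at h1
  exact V.sub_resolvent_injective (V.resolvent_injective h1)

end Projections

end StandardSubspace

/-! ### Modular conjugations through the bounded operator `P - Q` -/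

namespace StandardSubspace

variable {H : Type*} [NormedAddCommGroup H] [InnerProductSpace ℂ H]
  (V : StandardSubspace H)

variable {V} in
lemma tomita_apply_of_eq {K : Conjugation H} {D : H →ₗ.[ℂ] H}
    (h : V.tomita = (K.toEquiv.toLinearEquiv : H →ₛₗ[starRingEnd ℂ] H).compPMap D) (x : H)
    (h1 : x ∈ V.tomita.domain) (h2 : x ∈ D.domain) :
    V.tomita ⟨x, h1⟩ = K.toEquiv (D ⟨x, h2⟩) := by
  have key : ∀ S : H →ₛₗ.[starRingEnd ℂ] H,
      S = (K.toEquiv.toLinearEquiv : H →ₛₗ[starRingEnd ℂ] H).compPMap D →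
      ∀ h1 : x ∈ S.domain, S ⟨x, h1⟩ = K.toEquiv (D ⟨x, h2⟩) := by
    rintro _ rfl _
    rfl
  exact key _ h h1

variable [CompleteSpace H]

/-- `K` is the antiunitary part of the bounded antilinear operator `P - Q`. -/
def IsPolarConjugation (K : Conjugation H) : Prop :=
  ∃ T : H →L[ℂ] H, 0 ≤ T ∧ ∀ x, K.toEquiv (T x) = V.diff x

variable {V}

/-- The positive part of `P - Q` is the square root of `(P - Q)²`, and it has dense range. -/
lemma IsPolarConjugation.unique {K K' : Conjugation H} (hK : V.IsPolarConjugation K)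
    (hK' : V.IsPolarConjugation K') : K = K' := by
  obtain ⟨T, hT, h⟩ := hK
  obtain ⟨T', hT', h'⟩ := hK'
  have hTT : T = T' := by
    apply eq_of_mul_self_eq hT hT'
    ext x
    refine ext_inner_right ℂ fun y => ?_
    rw [mul_apply_eq_comp, mul_apply_eq_comp, inner_map_of_nonneg hT, inner_map_of_nonneg hT',
      ← inner_antiunitary_map K.toEquiv (T y) (T x),
      ← inner_antiunitary_map K'.toEquiv (T' y) (T' x), h, h, h', h']
  subst hTT
  have hdense : DenseRange T := denseRange_of_nonneg hT fun x hx =>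
    V.diff_injective (by rw [← h, hx, map_zero])
  have heq : (K.toEquiv : H → H) = K'.toEquiv :=
    hdense.equalizer K.toEquiv.continuous K'.toEquiv.continuous
      (funext fun x => (h x).trans (h' x).symm)
  exact Conjugation.ext_of_apply (congrFun heq)

lemma proj_unitaryImage (g : H ≃ₗᵢ[ℂ] H) (x : H) :
    (g • V).proj x = g (V.proj (g.symm x)) := by
  apply proj_eq_of_mem
  · rw [mem_smul_iff, g.symm_apply_apply]
    exact V.proj_mem _
  · intro v hv
    rw [mem_smul_iff] at hv
    have h := V.re_inner_proj (g.symm x) (g.symm v)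
    rw [V.proj_eq_self_iff.2 hv] at h
    rw [inner_sub_left, Complex.sub_re, sub_eq_zero]
    conv_lhs => rw [← g.symm.inner_map_map]
    conv_rhs => rw [← g.symm.inner_map_map, g.symm_apply_apply]
    exact h.symm

lemma diff_unitaryImage (g : H ≃ₗᵢ[ℂ] H) (x : H) :
    (g • V).diff x = g (V.diff (g.symm x)) := by
  simp [diff_apply, projI, proj_unitaryImage]

lemma proj_conjImage (L : Conjugation H) (x : H) :
    (V.conjImage L).proj x = L.toEquiv (V.proj (L.toEquiv x)) := by
  apply proj_eq_of_mem
  · rw [mem_conjImage, L.apply_apply]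
    exact V.proj_mem _
  · intro v hv
    rw [mem_conjImage] at hv
    have h := V.re_inner_proj (L.toEquiv v) (L.toEquiv x)
    rw [V.proj_eq_self_iff.2 hv] at h
    rw [inner_sub_left, Complex.sub_re, sub_eq_zero]
    conv_lhs => rw [← inner_antiunitary_map L.toEquiv]
    conv_rhs => rw [← inner_antiunitary_map L.toEquiv, L.apply_apply]
    exact h

lemma diff_conjImage (L : Conjugation H) (x : H) :
    (V.conjImage L).diff x = L.toEquiv (V.diff (L.toEquiv x)) := by
  simp [diff_apply, projI, proj_conjImage, LinearIsometryEquiv.map_smulₛₗ, sub_eq_add_neg]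

end StandardSubspace

namespace Conjugation

variable {H : Type*} [NormedAddCommGroup H] [InnerProductSpace ℂ H]

/-- The conjugation `g K g⁻¹`. -/
def unitaryConj (g : H ≃ₗᵢ[ℂ] H) (K : Conjugation H) : Conjugation H where
  toEquiv := (g.symm.trans K.toEquiv).trans g
  involutive x := by simp [K.apply_apply]

@[simp]
lemma unitaryConj_apply (g : H ≃ₗᵢ[ℂ] H) (K : Conjugation H) (x : H) :
    (K.unitaryConj g).toEquiv x = g (K.toEquiv (g.symm x)) := rfl

/-- The conjugation `L K L`. -/
def conjConj (L K : Conjugation H) : Conjugation H where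
  toEquiv := (L.toEquiv.trans (K.toEquiv.trans L.toEquiv : H ≃ₗᵢ[ℂ] H))
  involutive x := by simp [K.apply_apply, L.apply_apply]

@[simp]
lemma conjConj_apply (L K : Conjugation H) (x : H) :
    (L.conjConj K).toEquiv x = L.toEquiv (K.toEquiv (L.toEquiv x)) := rfl

end Conjugation

namespace StandardSubspace

variable {H : Type*} [NormedAddCommGroup H] [InnerProductSpace ℂ H] [CompleteSpace H]
  {V : StandardSubspace H}

lemma IsPolarConjugation.smul {K : Conjugation H} (hK : V.IsPolarConjugation K)
    (g : H ≃ₗᵢ[ℂ] H) : (g • V).IsPolarConjugation (K.unitaryConj g) := by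
  obtain ⟨T, hT, h⟩ := hK
  refine ⟨(g : H →L[ℂ] H).comp (T.comp (g.symm : H →L[ℂ] H)), ?_, fun x => ?_⟩
  · have key : ∀ x y, inner ℂ (g (T (g.symm x))) y = inner ℂ (T (g.symm x)) (g.symm y) := by
      intro x y
      rw [← g.symm.inner_map_map, g.symm_apply_apply]
    apply nonneg_of_re
    · intro x y
      change (inner ℂ (g (T (g.symm x))) y).re = (inner ℂ x (g (T (g.symm y)))).re
      rw [key, ← inner_conj_symm x, key, inner_map_of_nonneg hT, ← inner_conj_symm]
    · intro x
      change 0 ≤ (inner ℂ (g (T (g.symm x))) x).re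
      rw [key]
      exact re_inner_map_self_nonneg hT _
  · simp [diff_unitaryImage, h]

lemma IsPolarConjugation.conjImage {K : Conjugation H} (hK : V.IsPolarConjugation K)
    (L : Conjugation H) : (V.conjImage L).IsPolarConjugation (L.conjConj K) := by
  obtain ⟨T, hT, h⟩ := hK
  refine ⟨antiConj L.toEquiv T, antiConj_nonneg _ hT, fun x => ?_⟩
  simp [diff_conjImage, h, L.symm_toEquiv, L.apply_apply]

/-! ### From the modular operator to bounded operators -/

variable (V)

lemma resolvent_eq (x : H) : V.resolvent x =
    (1 / 2 : ℝ) • V.proj x + Complex.I • ((1 / 2 : ℝ) • (-V.proj (Complex.I • x))) := by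
  rw [resolvent_apply, projI, ← Complex.coe_smul, ← Complex.coe_smul]
  push_cast
  module

lemma resolvent_mem (x : H) : V.resolvent x ∈ V.tomita.domain :=
  ⟨_, SMulMemClass.smul_mem _ (V.proj_mem x), _,
    SMulMemClass.smul_mem _ ((neg_mem_iff' _ _).2 (V.proj_mem _)), V.resolvent_eq x⟩

lemma tomita_resolvent (x : H) :
    V.tomita ⟨V.resolvent x, V.resolvent_mem x⟩ = (1 / 2 : ℂ) • V.diff x := by
  rw [V.tomita_apply _ (SMulMemClass.smul_mem (1 / 2 : ℝ) (V.proj_mem x))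
    (SMulMemClass.smul_mem (1 / 2 : ℝ) ((neg_mem_iff' _ _).2 (V.proj_mem (Complex.I • x))))
    (V.resolvent_eq x), diff_apply, projI, ← Complex.coe_smul, ← Complex.coe_smul]
  push_cast
  module

lemma inner_sub_resolvent_of_mem (x : H) {v : H} (hv : v ∈ V.toClosedSubmodule) :
    inner ℂ (x - V.resolvent x) v = inner ℂ v ((1 / 2 : ℂ) • V.diff x) := by
  have hv' := V.proj_eq_self_iff.2 hv
  have hvI : V.projI (Complex.I • v) = Complex.I • v := by rw [projI_I_smul, hv']
  have h1 := V.re_inner_proj x v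
  have h2 := V.re_inner_projI x (Complex.I • v)
  rw [hv'] at h1
  rw [hvI, inner_smul_right, inner_smul_right] at h2
  simp only [Complex.mul_re, Complex.I_re, Complex.I_im, zero_mul, one_mul, zero_sub] at h2
  have h3 : ∀ u : H, (inner ℂ v u).re = (inner ℂ u v).re := fun u => by
    rw [← inner_conj_symm v u, Complex.conj_re]
  have h4 : ∀ u : H, (inner ℂ v u).im = -(inner ℂ u v).im := fun u => by
    rw [← inner_conj_symm v u, Complex.conj_im]
  apply Complex.ext
  · simp [resolvent_apply, diff_apply, h3 (V.proj x), h3 (V.projI x)]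
    linarith
  · simp [resolvent_apply, diff_apply, h4 (V.proj x), h4 (V.projI x)]
    linarith

/-- The identity `B = (1 + Δ)⁻¹`. -/
lemma isModularValue_resolvent (x : H) :
    V.IsModularValue (V.resolvent x) (x - V.resolvent x) := by
  refine ⟨V.resolvent_mem x, fun z => ?_⟩
  obtain ⟨v, hv, w, hw, hz⟩ := z.2
  rw [tomita_resolvent, V.tomita_apply z hv hw hz, hz, inner_add_right, inner_smul_right,
    inner_sub_resolvent_of_mem V x hv, inner_sub_resolvent_of_mem V x hw,
    inner_sub_left, inner_smul_left]
  generalize (1 / 2 : ℂ) • V.diff x = u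
  simp

variable {V}

/-- The positive part of `P - Q` is `2 Δ^{1/2} (1 + Δ)⁻¹`. -/
lemma IsModularConjugation.isPolarConjugation {K : Conjugation H}
    (hK : V.IsModularConjugation K) : V.IsPolarConjugation K := by
  obtain ⟨D, hD, hS⟩ := hK
  have hdom : ∀ x, V.resolvent x ∈ D.domain := fun x => by
    have h := V.resolvent_mem x
    rw [hS] at h
    exact h
  have hadj : ∀ x y : D.domain, inner ℂ (D x) (y : H) = inner ℂ (x : H) (D y) := by
    have h := LinearPMap.adjoint_isFormalAdjoint hD.selfAdjoint.dense_domain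
    rw [LinearPMap.isSelfAdjoint_def.1 hD.selfAdjoint] at h
    exact h
  set d : H → H := fun x => D ⟨V.resolvent x, hdom x⟩ with hd
  have hd2 : ∀ x, ∃ h : d x ∈ D.domain, D ⟨d x, h⟩ = x - V.resolvent x := fun x => by
    obtain ⟨_, h2, h3⟩ := (hD.sq _ _).2 (V.isModularValue_resolvent x)
    exact ⟨h2, h3⟩
  have hdiff : ∀ x, K.toEquiv (V.diff x) = (2 : ℂ) • d x := fun x => by
    have h1 := tomita_apply_of_eq hS (V.resolvent x) (V.resolvent_mem x) (hdom x)
    rw [tomita_resolvent] at h1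
    have h2 : V.diff x = (2 : ℂ) • K.toEquiv (d x) := by
      rw [hd, ← h1, smul_smul]
      norm_num
    rw [h2, K.toEquiv.map_smulₛₗ, K.apply_apply, map_ofNat]
  -- inserting `y = B y + (1 - B) y` with `(1 - B) y = D² B y` shows that `D B` is positive
  have hsplit : ∀ x y, inner ℂ (d x) y =
      inner ℂ (d x) (V.resolvent y) + inner ℂ (d x) (y - V.resolvent y) := fun x y => by
    rw [← inner_add_right, add_sub_cancel]
  have hsymm : ∀ x y, inner ℂ (d x) y = inner ℂ x (d y) := fun x y => by
    obtain ⟨hx, hx'⟩ := hd2 x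
    obtain ⟨hy, hy'⟩ := hd2 y
    rw [hsplit, ← hy', ← hadj ⟨d x, hx⟩ ⟨d y, hy⟩, hx',
      hadj ⟨V.resolvent x, hdom x⟩ ⟨V.resolvent y, hdom y⟩, inner_sub_left]
    exact add_sub_cancel _ _
  have hpos : ∀ x, 0 ≤ (inner ℂ (d x) x).re := fun x => by
    obtain ⟨hx, hx'⟩ := hd2 x
    rw [hsplit, ← hx', hadj ⟨V.resolvent x, hdom x⟩ ⟨V.resolvent x, hdom x⟩, Complex.add_re]
    exact add_nonneg (hD.nonneg ⟨V.resolvent x, hdom x⟩) (hD.nonneg ⟨d x, hx⟩)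
  have hT : ∀ x, ((K.toEquiv : H →L⋆[ℂ] H).comp V.diff : H →L[ℂ] H) x = (2 : ℂ) • d x := hdiff
  refine ⟨(K.toEquiv : H →L⋆[ℂ] H).comp V.diff, ?_, fun x => K.involutive _⟩
  apply nonneg_of_re
  · intro x y
    rw [hT, hT, inner_smul_left, inner_smul_right, hsymm]
    simp
  · intro x
    rw [hT, inner_smul_left]
    simpa using hpos x

end StandardSubspace

/-! ### Selfadjoint operators given by a cosine and a sine -/

section CosSin

variable {H : Type*} [NormedAddCommGroup H] [InnerProductSpace ℂ H]

/-- The unbounded operator `s c⁻¹` with domain the range of the injective bounded operator `c`. -/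
noncomputable def divPMap (c s : H →L[ℂ] H) (hc : Function.Injective c) : H →ₗ.[ℂ] H where
  domain := LinearMap.range (c : H →ₗ[ℂ] H)
  toFun := (s : H →ₗ[ℂ] H) ∘ₗ (LinearEquiv.ofInjective (c : H →ₗ[ℂ] H) hc).symm.toLinearMap

lemma apply_mem_divPMap_domain (c s : H →L[ℂ] H) (hc : Function.Injective c) (x : H) :
    c x ∈ (divPMap c s hc).domain := ⟨x, rfl⟩

lemma divPMap_apply (c s : H →L[ℂ] H) (hc : Function.Injective c) (x : H) :
    divPMap c s hc ⟨c x, apply_mem_divPMap_domain c s hc x⟩ = s x := by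
  have h1 : (LinearEquiv.ofInjective (c : H →ₗ[ℂ] H) hc).symm
      ⟨c x, apply_mem_divPMap_domain c s hc x⟩ = x := by
    rw [LinearEquiv.symm_apply_eq]
    rfl
  exact congrArg s h1

variable [CompleteSpace H]

/-- If `c` and `s` are commuting positive operators with `c² + s² = 1`, then `s c⁻¹` is
selfadjoint: from `c z = s y` it follows that `y = c (c y + s z)` and `z = s (c y + s z)`. -/
lemma isSelfAdjoint_divPMap {c s : H →L[ℂ] H} (hc : Function.Injective c) (hc0 : 0 ≤ c)
    (hs0 : 0 ≤ s) (hcs : Commute c s) (h1 : c * c + s * s = 1) :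
    IsSelfAdjoint (divPMap c s hc) := by
  have hdense : Dense ((divPMap c s hc).domain : Set H) :=
    denseRange_of_nonneg hc0 fun x hx => hc (by rw [hx, map_zero])
  have hcs' : ∀ x, c (s x) = s (c x) := fun x => DFunLike.congr_fun hcs.eq x
  have h1' : ∀ x, c (c x) + s (s x) = x := fun x => DFunLike.congr_fun h1 x
  rw [LinearPMap.isSelfAdjoint_def]
  symm
  have hle : divPMap c s hc ≤ (divPMap c s hc).adjoint := by
    apply LinearPMap.IsFormalAdjoint.le_adjoint hdense
    rintro ⟨_, x, rfl⟩ ⟨_, y, rfl⟩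
    change inner ℂ (divPMap c s hc ⟨c x, apply_mem_divPMap_domain c s hc x⟩) (c y) =
      inner ℂ (c x) (divPMap c s hc ⟨c y, apply_mem_divPMap_domain c s hc y⟩)
    rw [divPMap_apply, divPMap_apply, inner_map_of_nonneg hs0, inner_map_of_nonneg hc0, hcs']
  refine LinearPMap.eq_of_le_of_domain_eq hle (le_antisymm hle.1 fun y hy => ?_)
  set z := (divPMap c s hc).adjoint ⟨y, hy⟩
  have h2 : c z = s y := by
    refine ext_inner_right ℂ fun x => ?_
    have h3 := LinearPMap.adjoint_isFormalAdjoint hdense ⟨y, hy⟩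
      ⟨c x, apply_mem_divPMap_domain c s hc x⟩
    rw [divPMap_apply] at h3
    rw [inner_map_of_nonneg hc0, inner_map_of_nonneg hs0]
    exact h3
  refine ⟨c y + s z, ?_⟩
  change c (c y + s z) = y
  rw [map_add, hcs', h2, h1']

end CosSin

/-! ### Existence of the modular conjugation -/

namespace StandardSubspace

variable {H : Type*} [NormedAddCommGroup H] [InnerProductSpace ℂ H] [CompleteSpace H]
  (V : StandardSubspace H)

lemma norm_half_diff_sq (x : H) :
    ‖(1 / 2 : ℂ) • V.diff x‖ ^ 2 =
      (inner ℂ (V.resolvent x - V.resolvent (V.resolvent x)) x).re := by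
  have h : ‖V.diff x‖ ^ 2 = (inner ℂ (V.diff (V.diff x)) x).re := by
    rw [re_inner_diff, ← RCLike.re_to_complex, inner_self_eq_norm_sq]
  rw [norm_smul, mul_pow, h, diff_diff, inner_smul_left]
  simp only [inner_sub_left, Complex.sub_re, Complex.mul_re]
  simp
  ring

lemma denseRange_half_diff : DenseRange ((1 / 2 : ℂ) • V.diff) := by
  apply denseRange_of_inner_eq_zero
  intro y hy
  apply V.diff_injective
  rw [← inner_self_eq_zero (𝕜 := ℂ), ← inner_diff]
  have h := hy (V.diff y)
  rw [smul_apply, inner_smul_left] at h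
  simpa using h

/-- If a positive operator `T` is the absolute value of the antilinear operator `(P - Q) / 2`, then
the antiunitary operator in the polar decomposition is an involution and commutes with `T`. -/
lemma exists_conjugation_of_mul_self_eq {T : H →L[ℂ] H} (hT : 0 ≤ T)
    (hTT : T * T = V.resolvent - V.resolvent * V.resolvent) :
    ∃ K : Conjugation H, (∀ x, K.toEquiv (T x) = (1 / 2 : ℂ) • V.diff x) ∧
      ∀ x, K.toEquiv (T x) = T (K.toEquiv x) := by
  have hTT' : ∀ x, T (T x) = V.resolvent x - V.resolvent (V.resolvent x) :=
    fun x => DFunLike.congr_fun hTT x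
  have hnorm : ∀ x, ‖((1 / 2 : ℂ) • V.diff) x‖ = ‖T x‖ := fun x => by
    rw [← sq_eq_sq₀ (norm_nonneg _) (norm_nonneg _), norm_sq_of_nonneg hT, mul_apply_eq_comp,
      hTT', smul_apply, norm_half_diff_sq]
  have hTinj : ∀ x, T x = 0 → x = 0 := fun x hx => by
    have h := hnorm x
    rw [hx, norm_zero, norm_eq_zero, smul_apply, smul_eq_zero_iff_right (by norm_num)] at h
    exact V.diff_injective h
  have hTdense : DenseRange T := denseRange_of_nonneg hT hTinj
  obtain ⟨L, hL⟩ := exists_antiunitary_of_norm_eq hnorm hTdense V.denseRange_half_diff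
  have hLT2 : ∀ x, L (T (T x)) = T (T (L x)) := by
    refine congrFun (hTdense.equalizer (by fun_prop) (by fun_prop) (funext fun x => ?_))
    simp only [Function.comp_apply]
    rw [hL, hL, hTT', hTT']
    simp only [smul_apply, map_sub, map_smul, diff_resolvent]
    module
  -- `T` and `L T L⁻¹` are positive square roots of the same operator
  have hLT : ∀ x, L (T x) = T (L x) := by
    have h : antiConj L T = T := by
      apply eq_of_mul_self_eq (antiConj_nonneg L hT) hT
      rw [← antiConj_mul]
      ext x
      simp [hLT2]
    intro x
    have h2 := DFunLike.congr_fun h (L x)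
    rwa [antiConj_apply, L.symm_apply_apply] at h2
  -- the symmetry of `P - Q = 2 L T` turns into `L = L⁻¹`
  have hinv : ∀ x, L x = L.symm x := by
    intro x
    have hd : Dense (LinearMap.range (T : H →ₗ[ℂ] H) : Set H) := hTdense
    apply hd.eq_of_inner_left ℂ
    rintro _ ⟨y, rfl⟩
    change inner ℂ (L x) (T y) = inner ℂ (L.symm x) (T y)
    rw [← inner_map_of_nonneg hT, ← hLT, ← inner_antiunitary_map L (T y), L.apply_symm_apply, hL,
      hL, smul_apply, smul_apply, inner_smul_left, inner_smul_left, inner_diff]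
  refine ⟨⟨L, fun x => ?_⟩, hL, hLT⟩
  rw [hinv, L.symm_apply_apply]

/-- With `c = B^{1/2}` and `s = (1 - B)^{1/2}` the modular operator is `Δ^{1/2} = s c⁻¹`, and the
modular conjugation is the antiunitary part of `P - Q = 2 J c s`. -/
lemma exists_isModularConjugation : ∃ K : Conjugation H, V.IsModularConjugation K := by
  set B := V.resolvent with hB
  set c := CFC.sqrt B with hc
  set s := CFC.sqrt (1 - B) with hs
  have hc0 : 0 ≤ c := CFC.sqrt_nonneg _
  have hs0 : 0 ≤ s := CFC.sqrt_nonneg _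
  have hcc : c * c = B := CFC.sqrt_mul_sqrt_self _ V.resolvent_nonneg
  have hss : s * s = 1 - B := CFC.sqrt_mul_sqrt_self _ V.one_sub_resolvent_nonneg
  have hcB : Commute c B := commute_sqrt (Commute.refl _)
  have hsB : Commute s B :=
    commute_sqrt ((Commute.one_left _).sub_left (Commute.refl _))
  have hcs : Commute c s := (commute_sqrt ((Commute.one_left _).sub_left hcB.symm)).symm
  have h1 : c * c + s * s = 1 := by rw [hcc, hss, add_sub_cancel]
  have hT0 : 0 ≤ c * s := hcs.mul_nonneg hc0 hs0
  have hTT : c * s * (c * s) = B - B * B := by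
    rw [hcs.symm.mul_mul_mul_comm, hcc, hss, mul_sub, mul_one]
  obtain ⟨K, hK, hKT⟩ := V.exists_conjugation_of_mul_self_eq hT0 hTT
  have hcs' : ∀ x, c (s x) = s (c x) := fun x => DFunLike.congr_fun hcs.eq x
  have hcc' : ∀ x, c (c x) = B x := fun x => DFunLike.congr_fun hcc x
  have hss' : ∀ x, s (s x) = x - B x := fun x => DFunLike.congr_fun hss x
  have hTB : ∀ x, c (s (B x)) = B (c (s x)) :=
    fun x => DFunLike.congr_fun (hcB.mul_left hsB).eq x
  have hK' : ∀ x, K.toEquiv (c (s x)) = (1 / 2 : ℂ) • V.diff x := hK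
  have hKT' : ∀ x, K.toEquiv (c (s x)) = c (s (K.toEquiv x)) := hKT
  have hsum : ∀ x, B x + (1 / 2 : ℂ) • V.diff x = V.proj x := fun x => by
    rw [hB, resolvent_apply, diff_apply]
    module
  have hcinj : ∀ x, c x = 0 → x = 0 := fun x hx =>
    V.resolvent_injective (by rw [← hB, ← hcc', hx, map_zero])
  have hcinj' : Function.Injective c := (injective_iff_map_eq_zero c).2 hcinj
  have hcdense : DenseRange c := denseRange_of_nonneg hc0 hcinj
  have hTdense : DenseRange (c * s) := by
    apply denseRange_of_nonneg hT0
    intro x hx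
    apply V.diff_injective
    have h := hK x
    rw [hx, map_zero, eq_comm, smul_eq_zero_iff_right (by norm_num)] at h
    exact h
  -- `K` exchanges `B` and `1 - B`
  have hKB : ∀ x, K.toEquiv (B x) = K.toEquiv x - B (K.toEquiv x) := by
    refine congrFun (hTdense.equalizer (by fun_prop) (by fun_prop) (funext fun x => ?_))
    simp only [Function.comp_apply, mul_apply_eq_comp]
    rw [← hTB, hK', hK', hB, diff_resolvent, map_smul, smul_sub]
  -- the real part of `c x` with respect to `V + iV` is `(c x + K s x) / 2`
  have hmem : ∀ x, c x + K.toEquiv (s x) ∈ V.toClosedSubmodule := by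
    intro x
    rw [← proj_eq_self_iff]
    revert x
    refine congrFun (hcdense.equalizer (by fun_prop) (by fun_prop) (funext fun x => ?_))
    simp only [Function.comp_apply]
    rw [← hcs', hcc', hK', hsum, proj_proj]
  -- each `v ∈ V` is `c x` with `K s x = v = S v`; the solution is `x = c v + s K v`
  have hpre : ∀ v ∈ V.toClosedSubmodule, ∃ x, c x = v ∧ K.toEquiv (s x) = v := by
    intro v hv
    have hv' := V.proj_eq_self_iff.2 hv
    refine ⟨c v + s (K.toEquiv v), ?_, ?_⟩
    · rw [map_add, hcc', ← hKT', hK', hsum, hv']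
    · rw [map_add, ← hcs', hss', map_add, map_sub, hKB, hK', K.apply_apply, sub_sub_cancel,
        add_comm, hsum, hv']
  have hKI : ∀ x, K.toEquiv (Complex.I • x) = -(Complex.I • K.toEquiv x) := fun x => by
    rw [K.toEquiv.map_smulₛₗ, Complex.conj_I, neg_smul]
  set D := divPMap c s hcinj' with hD
  have hDsa : IsSelfAdjoint D := isSelfAdjoint_divPMap hcinj' hc0 hs0 hcs h1
  have hS : V.tomita = (K.toEquiv.toLinearEquiv : H →ₛₗ[starRingEnd ℂ] H).compPMap D := by
    have hdom : V.tomita.domain = D.domain := by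
      ext z
      constructor
      · rintro ⟨v, hv, w, hw, rfl⟩
        obtain ⟨x, hx, -⟩ := hpre v hv
        obtain ⟨y, hy, -⟩ := hpre w hw
        exact ⟨x + Complex.I • y, by
          change c (x + Complex.I • y) = _
          rw [map_add, map_smul, hx, hy]⟩
      · rintro ⟨x, rfl⟩
        refine ⟨(1 / 2 : ℝ) • (c x + K.toEquiv (s x)), SMulMemClass.smul_mem _ (hmem x),
          (-1 / 2 : ℝ) • (c (Complex.I • x) + K.toEquiv (s (Complex.I • x))),
          SMulMemClass.smul_mem _ (hmem _), ?_⟩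
        change c x = _
        rw [map_smul, map_smul, hKI, ← Complex.coe_smul, ← Complex.coe_smul]
        push_cast
        rw [← sub_eq_add_neg, ← smul_sub, smul_comm _ Complex.I, smul_smul, smul_smul,
          Complex.I_mul_I]
        module
    refine LinearPMap.ext hdom ?_
    rintro z hz1 hz2
    obtain ⟨v, hv, w, hw, rfl⟩ := hz1
    obtain ⟨x, hx, hx'⟩ := hpre v hv
    obtain ⟨y, hy, hy'⟩ := hpre w hw
    rw [V.tomita_apply _ hv hw rfl]
    have hz : v + Complex.I • w = c (x + Complex.I • y) := by rw [map_add, map_smul, hx, hy]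
    have hmemD : v + Complex.I • w ∈ D.domain := ⟨x + Complex.I • y, hz.symm⟩
    change _ = K.toEquiv (D ⟨v + Complex.I • w, hmemD⟩)
    have hDz : D ⟨v + Complex.I • w, hmemD⟩ = s (x + Complex.I • y) := by
      rw [← divPMap_apply c s hcinj' (x + Complex.I • y)]
      congr 2
    rw [hDz, map_add, map_smul, map_add, hKI, hx', hy', sub_eq_add_neg]
  refine ⟨K, D, ⟨hDsa, ?_, ?_⟩, hS⟩
  · rintro ⟨_, x, rfl⟩
    change 0 ≤ (inner ℂ (c x)
      (divPMap c s hcinj' ⟨c x, apply_mem_divPMap_domain c s hcinj' x⟩)).re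
    rw [divPMap_apply, inner_map_of_nonneg hc0, ← mul_apply_eq_comp,
      ← inner_map_of_nonneg hT0]
    exact re_inner_map_self_nonneg hT0 x
  · -- both sides say that `D x` lies in the domain of `D† = D` with `D† D x = y`
    intro x y
    have hdom : ∀ x, x ∈ V.tomita.domain ↔ x ∈ D.domain := fun x => by
      rw [hS]
      rfl
    have hadj := LinearPMap.adjoint_isFormalAdjoint hDsa.dense_domain
    constructor
    · rintro ⟨hx, hDx, rfl⟩
      refine ⟨(hdom x).2 hx, fun z => ?_⟩
      have hz := (hdom z).1 z.2
      rw [tomita_apply_of_eq hS x _ hx, tomita_apply_of_eq hS z z.2 hz, inner_antiunitary_map]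
      rw [LinearPMap.isSelfAdjoint_def.1 hDsa] at hadj
      exact hadj ⟨D ⟨x, hx⟩, hDx⟩ ⟨z, hz⟩
    · rintro ⟨hx, h⟩
      have hx' := (hdom x).1 hx
      have h2 : ∀ z : D.domain, inner ℂ y (z : H) = inner ℂ (D ⟨x, hx'⟩) (D z) := fun z => by
        have h3 := h ⟨z, (hdom z).2 z.2⟩
        rwa [tomita_apply_of_eq hS x hx hx', tomita_apply_of_eq hS z _ z.2,
          inner_antiunitary_map] at h3
      have hmemA := LinearPMap.mem_adjoint_domain_of_exists _ ⟨y, h2⟩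
      have hval := LinearPMap.adjoint_apply_eq hDsa.dense_domain ⟨_, hmemA⟩ h2
      have hAD : D.adjoint = D := hDsa
      have key : ∀ A : H →ₗ.[ℂ] H, A = D → ∀ (u : H) (hu : u ∈ A.domain), A ⟨u, hu⟩ = y →
          ∃ hu' : u ∈ D.domain, D ⟨u, hu'⟩ = y := by
        rintro _ rfl u hu hval
        exact ⟨hu, hval⟩
      obtain ⟨h5, h6⟩ := key _ hAD _ hmemA hval
      exact ⟨hx', h5, h6⟩

end StandardSubspace

namespace StandardSubspace

variable {H : Type*} [NormedAddCommGroup H] [InnerProductSpace ℂ H] [CompleteSpace H]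

lemma isModularConjugation_modularConj (V : StandardSubspace H) :
    V.IsModularConjugation V.modularConj := by
  have h := V.exists_isModularConjugation
  rw [modularConj, dif_pos h]
  exact h.choose_spec

lemma isModularConjugation_iff (V : StandardSubspace H) (K : Conjugation H) :
    V.IsModularConjugation K ↔ K = V.modularConj := by
  constructor
  · exact fun h =>
      h.isPolarConjugation.unique V.isModularConjugation_modularConj.isPolarConjugation
  · rintro rfl
    exact V.isModularConjugation_modularConj

lemma isPolarConjugation_modularConj (V : StandardSubspace H) :
    V.IsPolarConjugation V.modularConj :=
  V.isModularConjugation_modularConj.isPolarConjugation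

lemma modularConj_smul (g : H ≃ₗᵢ[ℂ] H) (V : StandardSubspace H) :
    (g • V).modularConj = V.modularConj.unitaryConj g :=
  (g • V).isPolarConjugation_modularConj.unique (V.isPolarConjugation_modularConj.smul g)

lemma modularConj_conjImage (L : Conjugation H) (V : StandardSubspace H) :
    (V.conjImage L).modularConj = L.conjConj V.modularConj :=
  (V.conjImage L).isPolarConjugation_modularConj.unique
    (V.isPolarConjugation_modularConj.conjImage L)

end StandardSubspace

/-! ### Conjugations are unitarily equivalent -/

namespace Conjugation

variable {H : Type*} [NormedAddCommGroup H] [InnerProductSpace ℂ H]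

lemma inner_apply_left (J : Conjugation H) (x y : H) :
    inner ℂ (J.toEquiv x) y = inner ℂ (J.toEquiv y) x := by
  conv_lhs => rw [← J.apply_apply y]
  rw [inner_antiunitary_map]

lemma apply_I_smul (J : Conjugation H) (x : H) :
    J.toEquiv (Complex.I • x) = -(Complex.I • J.toEquiv x) := by
  rw [J.toEquiv.map_smulₛₗ, Complex.conj_I, neg_smul]

/-- Any two conjugations are conjugate under the unitary group. The normal operator `A = 1 + K J`
satisfies `K A = A J`; its absolute value commutes with `J`, so its polar part intertwines
`J` and `K` on the orthogonal complement of its kernel. On the kernel `K = -J`, and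
multiplication by `i` intertwines `J` and `K`. -/
lemma exists_unitaryConj_eq [CompleteSpace H] (J K : Conjugation H) :
    ∃ g : H ≃ₗᵢ[ℂ] H, J.unitaryConj g = K := by
  let A : H →L[ℂ] H := 1 + (K.toEquiv : H →L⋆[ℂ] H).comp (J.toEquiv : H →L⋆[ℂ] H)
  let A' : H →L[ℂ] H := 1 + (J.toEquiv : H →L⋆[ℂ] H).comp (K.toEquiv : H →L⋆[ℂ] H)
  have hA : ∀ x, A x = x + K.toEquiv (J.toEquiv x) := fun x => rfl
  have hA' : ∀ x, A' x = x + J.toEquiv (K.toEquiv x) := fun x => rfl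
  have hadj : ∀ x y, inner ℂ (A x) y = inner ℂ x (A' y) := fun x y => by
    rw [hA, hA', inner_add_left, inner_add_right, K.inner_apply_left,
      ← inner_antiunitary_map J.toEquiv (J.toEquiv _) x, J.apply_apply]
  have hker : ∀ x, A' x = 0 ↔ A x = 0 := fun x => by
    have h : A x = K.toEquiv (J.toEquiv (A' x)) := by
      rw [hA, hA', map_add, map_add, J.apply_apply, K.apply_apply, add_comm]
    rw [h, LinearIsometryEquiv.map_eq_zero_iff, LinearIsometryEquiv.map_eq_zero_iff]
  have hJA : ∀ x, A (J.toEquiv x) = K.toEquiv (A x) := fun x => by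
    simp only [hA, map_add, J.apply_apply, K.apply_apply]
    abel
  have hA'J : ∀ x, A' (K.toEquiv x) = J.toEquiv (A' x) := fun x => by
    simp only [hA', map_add, J.apply_apply, K.apply_apply]
    abel
  have hpos : 0 ≤ A' * A := by
    apply nonneg_of_re
    · intro x y
      rw [mul_apply_eq_comp, mul_apply_eq_comp, ← hadj x, ← inner_conj_symm, ← hadj,
        inner_conj_symm]
    · intro x
      rw [mul_apply_eq_comp, ← inner_conj_symm, Complex.conj_re, ← hadj, ← RCLike.re_to_complex]
      exact inner_self_nonneg
  -- the absolute value of `A`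
  set C := CFC.sqrt (A' * A) with hC
  have hC0 : 0 ≤ C := CFC.sqrt_nonneg _
  have hCC : C * C = A' * A := CFC.sqrt_mul_sqrt_self _ hpos
  have hnormC : ∀ x, ‖C x‖ = ‖A x‖ := fun x => by
    rw [← sq_eq_sq₀ (norm_nonneg _) (norm_nonneg _), norm_sq_of_nonneg hC0, hCC,
      mul_apply_eq_comp, ← inner_conj_symm, Complex.conj_re, ← hadj, ← RCLike.re_to_complex,
      inner_self_eq_norm_sq]
  have hCker : ∀ x, A x = 0 → C x = 0 := fun x hx => by
    rw [← norm_eq_zero, hnormC, hx, norm_zero]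
  -- `J C J` and `C` are positive square roots of the same operator
  have hCJ : ∀ x, C (J.toEquiv x) = J.toEquiv (C x) := by
    have h : antiConj J.toEquiv C = C := by
      apply eq_of_mul_self_eq (antiConj_nonneg _ hC0) hC0
      rw [← antiConj_mul, hCC]
      ext x
      simp only [antiConj_apply, J.symm_toEquiv, mul_apply_eq_comp]
      rw [hJA, hA'J, J.apply_apply]
    intro x
    have h2 := DFunLike.congr_fun h (J.toEquiv x)
    rw [antiConj_apply, J.symm_toEquiv, J.apply_apply] at h2
    exact h2.symm
  -- the projection onto the kernel of `A`
  let N : Submodule ℂ H := LinearMap.ker (A : H →ₗ[ℂ] H)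
  have hN : ∀ x, x ∈ N ↔ A x = 0 := fun x => Iff.rfl
  have : CompleteSpace N := (ContinuousLinearMap.isClosed_ker A).completeSpace_coe
  let E : H →L[ℂ] H := N.starProjection
  have hAE : ∀ x, A (E x) = 0 := fun x => N.starProjection_apply_mem x
  have hEE : ∀ x y, inner ℂ (E x) y = inner ℂ x (E y) := fun x y =>
    N.starProjection_isSymmetric x y
  have hEself : ∀ x, A x = 0 → E x = x := fun x hx => Submodule.starProjection_eq_self_iff.2 hx
  have hEA : ∀ x, E (A x) = 0 := fun x => by
    refine ext_inner_right ℂ fun y => ?_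
    rw [hEE, hadj, (hker _).2 (hAE y), inner_zero_right, inner_zero_left]
  have hEA' : ∀ x, E (A' x) = 0 := fun x => by
    refine ext_inner_left ℂ fun y => ?_
    rw [← hEE, ← hadj, hAE y, inner_zero_left, inner_zero_right]
  have hEJ : ∀ x, E (J.toEquiv x) = J.toEquiv (E x) := fun x => by
    apply Submodule.eq_starProjection_of_mem_of_inner_eq_zero
    · rw [hN, hJA, hAE, map_zero]
    · intro w hw
      have hw' : A (J.toEquiv w) = 0 := by rw [hJA, (hN w).1 hw, map_zero]
      rw [← map_sub, J.inner_apply_left, inner_sub_right, ← hEE, hEself _ hw', sub_self]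
  have hKE : ∀ x, K.toEquiv (E x) = -J.toEquiv (E x) := fun x => by
    have h := hAE (J.toEquiv x)
    rw [hEJ, hA, J.apply_apply] at h
    exact eq_neg_of_add_eq_zero_right h
  have hCE : ∀ x, inner ℂ (C x) (E x) = 0 := fun x => by
    rw [inner_map_of_nonneg hC0, hCker _ (hAE x), inner_zero_right]
  have hAEinner : ∀ x, inner ℂ (A x) (Complex.I • E x) = 0 := fun x => by
    rw [inner_smul_right, ← hEE, hEA, inner_zero_left, mul_zero]
  have hAI : ∀ x, (A + Complex.I • E) x = A x + Complex.I • E x := fun _ => rfl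
  have hCE' : ∀ x, (C + E) x = C x + E x := fun _ => rfl
  -- `C + E` and `A + i E` are injective with dense range and have the same norms, so that they
  -- define a unitary `g` with `g C = A` and `g = i` on the kernel of `A`
  have hnorm : ∀ x, ‖(A + Complex.I • E) x‖ = ‖(C + E) x‖ := fun x => by
    rw [← sq_eq_sq₀ (norm_nonneg _) (norm_nonneg _), hAI, hCE', sq, sq,
      norm_add_sq_eq_norm_sq_add_norm_sq_of_inner_eq_zero _ _ (hAEinner x),
      norm_add_sq_eq_norm_sq_add_norm_sq_of_inner_eq_zero _ _ (hCE x), hnormC, norm_smul]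
    simp
  have hM : DenseRange (C + E) := by
    apply denseRange_of_inner_eq_zero
    intro y hy
    have h1 : C y + E y = 0 := by
      rw [← inner_self_eq_zero (𝕜 := ℂ), inner_add_right]
      nth_rewrite 1 [← inner_map_of_nonneg hC0]
      rw [← hEE, ← inner_add_left]
      exact hy _
    have h2 : E (C y) = 0 := by
      refine ext_inner_right ℂ fun z => ?_
      rw [hEE, inner_map_of_nonneg hC0, hCker _ (hAE z), inner_zero_right, inner_zero_left]
    have h3 : E y = 0 := by
      have h4 := congrArg E h1
      rwa [map_add, h2, zero_add, map_zero, hEself _ (hAE y)] at h4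
    rw [h3, add_zero] at h1
    rw [← hEself y (by rw [← norm_eq_zero, ← hnormC, h1, norm_zero]), h3]
  have hN' : DenseRange (A + Complex.I • E) := by
    apply denseRange_of_inner_eq_zero
    intro y hy
    have h1 : A' y + -(Complex.I • E y) = 0 := by
      refine ext_inner_left ℂ fun x => ?_
      have h := hy x
      rw [hAI, inner_add_left, inner_smul_left, hadj, hEE] at h
      rw [inner_add_right, inner_neg_right, inner_smul_right, inner_zero_right, ← h]
      simp
    have h3 : E y = 0 := by
      have h4 := congrArg E h1
      rw [map_add, hEA', zero_add, map_neg, map_smul, map_zero, hEself _ (hAE y), neg_eq_zero,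
        smul_eq_zero_iff_right Complex.I_ne_zero] at h4
      exact h4
    rw [h3, smul_zero, neg_zero, add_zero] at h1
    rw [← hEself y ((hker y).1 h1), h3]
  obtain ⟨g, hg⟩ := exists_unitary_of_norm_eq hnorm hM hN'
  have hgJ : ∀ x, g (J.toEquiv x) = K.toEquiv (g x) := by
    refine congrFun (hM.equalizer (by fun_prop) (by fun_prop) (funext fun x => ?_))
    simp only [Function.comp_apply]
    have h1 : J.toEquiv ((C + E) x) = (C + E) (J.toEquiv x) := by
      rw [hCE', hCE', map_add, hCJ, hEJ]
    rw [h1, hg, hg, hAI, hAI, map_add, hJA,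
      K.apply_I_smul, hKE, hEJ, smul_neg, neg_neg]
  refine ⟨g, ext_of_apply fun x => ?_⟩
  rw [unitaryConj_apply, hgJ, g.apply_symm_apply]

/-! ### The orthogonal group of the real Hilbert space of fixed vectors -/

variable (J : Conjugation H)

/-- The real part `(x + J x) / 2` of a vector with respect to a conjugation. -/
noncomputable def realPart : H →ₗ[ℝ] J.fixedSpace where
  toFun x := ⟨(1 / 2 : ℝ) • (x + J.toRealCLE x), by
    change J.toRealCLE _ = _
    rw [map_smul, map_add, show J.toRealCLE (J.toRealCLE x) = x from J.involutive x, add_comm]⟩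
  map_add' x y := by
    apply Subtype.ext
    simp only [map_add, Submodule.coe_add]
    module
  map_smul' r x := by
    apply Subtype.ext
    simp only [map_smul, Submodule.coe_smul, RingHom.id_apply]
    module

lemma coe_realPart (x : H) : (J.realPart x : H) = (1 / 2 : ℂ) • (x + J.toEquiv x) := by
  change (1 / 2 : ℝ) • (x + J.toEquiv x) = _
  rw [← Complex.coe_smul]
  simp

lemma realPart_add_imagPart (x : H) :
    (J.realPart x : H) + Complex.I • (J.realPart (-(Complex.I • x)) : H) = x := by
  rw [coe_realPart, coe_realPart, map_neg, apply_I_smul, neg_neg, smul_smul,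
    mul_comm, ← smul_smul, smul_add Complex.I, smul_neg, smul_smul, smul_smul, Complex.I_mul_I]
  module

lemma realPart_of_fixed (p q : J.fixedSpace) : J.realPart ((p : H) + Complex.I • (q : H)) = p := by
  apply Subtype.ext
  rw [coe_realPart, map_add, apply_I_smul, J.mem_fixedSpace.1 p.2, J.mem_fixedSpace.1 q.2]
  module

lemma norm_add_I_smul_sq (p q : J.fixedSpace) :
    ‖(p : H) + Complex.I • (q : H)‖ ^ 2 = ‖p‖ ^ 2 + ‖q‖ ^ 2 := by
  have h : ‖(p : H) + Complex.I • (q : H)‖ = ‖(p : H) - Complex.I • (q : H)‖ := by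
    rw [← J.toEquiv.norm_map, map_add, apply_I_smul, J.mem_fixedSpace.1 p.2,
      J.mem_fixedSpace.1 q.2, sub_eq_add_neg]
  have h1 := norm_add_sq (𝕜 := ℂ) (p : H) (Complex.I • (q : H))
  have h2 := norm_sub_sq (𝕜 := ℂ) (p : H) (Complex.I • (q : H))
  rw [← h] at h2
  have h3 : ‖Complex.I • (q : H)‖ = ‖(q : H)‖ := by simp [norm_smul]
  rw [h3] at h1 h2
  change _ = ‖(p : H)‖ ^ 2 + ‖(q : H)‖ ^ 2
  linarith

/-- The complex linear extension of a real linear endomorphism of `H^J`. -/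
noncomputable def complexify (h : J.fixedSpace →ₗ[ℝ] J.fixedSpace) : H →ₗ[ℂ] H where
  toFun x := (h (J.realPart x) : H) + Complex.I • (h (J.realPart (-(Complex.I • x))) : H)
  map_add' x y := by
    simp only [smul_add, neg_add, map_add, Submodule.coe_add]
    abel
  map_smul' c x := by
    have h1 : c • x = c.re • x + c.im • (Complex.I • x) := by
      rw [← Complex.coe_smul, ← Complex.coe_smul, smul_smul, ← add_smul, Complex.re_add_im]
    have h2 : -(Complex.I • (c • x)) = c.re • -(Complex.I • x) + c.im • x := by
      rw [h1, smul_add, smul_comm Complex.I c.im, smul_smul Complex.I, Complex.I_mul_I,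
        smul_comm Complex.I c.re]
      module
    have h3 : J.realPart (Complex.I • x) = -J.realPart (-(Complex.I • x)) := by
      rw [map_neg, neg_neg]
    have h4 : h (J.realPart (c • x)) =
        c.re • h (J.realPart x) - c.im • h (J.realPart (-(Complex.I • x))) := by
      rw [h1, (J.realPart).map_add, (J.realPart).map_smul, (J.realPart).map_smul, h3, h.map_add,
        h.map_smul, h.map_smul, h.map_neg, smul_neg, sub_eq_add_neg]
    have h5 : h (J.realPart (-(Complex.I • (c • x)))) =
        c.re • h (J.realPart (-(Complex.I • x))) + c.im • h (J.realPart x) := by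
      rw [h2, (J.realPart).map_add, (J.realPart).map_smul, (J.realPart).map_smul, h.map_add,
        h.map_smul, h.map_smul]
    rw [h4, h5, Submodule.coe_sub, Submodule.coe_add, Submodule.coe_smul, Submodule.coe_smul,
      Submodule.coe_smul, Submodule.coe_smul, RingHom.id_apply]
    simp only [← Complex.coe_smul]
    match_scalars <;> apply Complex.ext <;> simp

lemma complexify_apply (h : J.fixedSpace →ₗ[ℝ] J.fixedSpace) (x : H) :
    J.complexify h x =
      (h (J.realPart x) : H) + Complex.I • (h (J.realPart (-(Complex.I • x))) : H) := rfl

lemma complexify_add_I_smul (h : J.fixedSpace →ₗ[ℝ] J.fixedSpace) (p q : J.fixedSpace) :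
    J.complexify h ((p : H) + Complex.I • (q : H)) = (h p : H) + Complex.I • (h q : H) := by
  have h1 : -(Complex.I • ((p : H) + Complex.I • (q : H))) =
      (q : H) + Complex.I • ((-p : J.fixedSpace) : H) := by
    rw [smul_add, smul_smul, Complex.I_mul_I, Submodule.coe_neg]
    module
  rw [complexify_apply, realPart_of_fixed, h1, realPart_of_fixed]

/-- The unitary extension of an orthogonal transformation of `H^J`. -/
noncomputable def complexifyIsometry (h : J.fixedSpace ≃ₗᵢ[ℝ] J.fixedSpace) : H ≃ₗᵢ[ℂ] H where
  toLinearEquiv := LinearEquiv.ofLinearMap (J.complexify h.toLinearEquiv)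
    (J.complexify h.symm.toLinearEquiv)
    (by
      ext x
      change J.complexify _ (J.complexify _ x) = x
      rw [J.complexify_apply h.symm.toLinearEquiv, complexify_add_I_smul]
      simpa using J.realPart_add_imagPart x)
    (by
      ext x
      change J.complexify _ (J.complexify _ x) = x
      rw [J.complexify_apply h.toLinearEquiv, complexify_add_I_smul]
      simpa using J.realPart_add_imagPart x)
  norm_map' x := by
    change ‖J.complexify h.toLinearEquiv x‖ = ‖x‖
    rw [← sq_eq_sq₀ (norm_nonneg _) (norm_nonneg _)]
    conv_rhs => rw [← J.realPart_add_imagPart x]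
    rw [complexify_apply, norm_add_I_smul_sq, norm_add_I_smul_sq]
    simp

lemma complexifyIsometry_add_I_smul (h : J.fixedSpace ≃ₗᵢ[ℝ] J.fixedSpace)
    (p q : J.fixedSpace) :
    J.complexifyIsometry h ((p : H) + Complex.I • (q : H)) = (h p : H) + Complex.I • (h q : H) :=
  J.complexify_add_I_smul h.toLinearEquiv p q

lemma apply_add_I_smul (p q : J.fixedSpace) :
    J.toEquiv ((p : H) + Complex.I • (q : H)) =
      (p : H) + Complex.I • ((-q : J.fixedSpace) : H) := by
  rw [map_add, apply_I_smul, J.mem_fixedSpace.1 p.2, J.mem_fixedSpace.1 q.2, Submodule.coe_neg,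
    smul_neg]

lemma complexifyIsometry_mem (h : J.fixedSpace ≃ₗᵢ[ℝ] J.fixedSpace) :
    J.complexifyIsometry h ∈ J.fixedUnitary := by
  rw [mem_fixedUnitary]
  ext x
  rw [tau_apply, ← J.realPart_add_imagPart x, apply_add_I_smul, complexifyIsometry_add_I_smul,
    complexifyIsometry_add_I_smul, apply_add_I_smul, map_neg, neg_neg]

theorem restrict_bijective : Function.Bijective J.restrict := by
  constructor
  · intro g g' h
    have key : ∀ p : J.fixedSpace, (g : H ≃ₗᵢ[ℂ] H) p = (g' : H ≃ₗᵢ[ℂ] H) p := fun p =>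
      congrArg (fun k : J.fixedSpace ≃ₗᵢ[ℝ] J.fixedSpace => (k p : H)) h
    apply Subtype.ext
    ext x
    rw [← J.realPart_add_imagPart x, map_add, map_add, map_smul, map_smul, key, key]
  · intro h
    refine ⟨⟨J.complexifyIsometry h, J.complexifyIsometry_mem h⟩, ?_⟩
    ext p
    change J.complexifyIsometry h (p : H) = h p
    have h1 := J.complexifyIsometry_add_I_smul h p 0
    simpa using h1

end Conjugation

/-! ### The reflection space of standard subspaces -/

namespace StandardSubspace

variable {H : Type*} [NormedAddCommGroup H] [InnerProductSpace ℂ H] [CompleteSpace H]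

lemma mem_reflect_iff (V W : StandardSubspace H) (x : H) :
    x ∈ (V.reflect W).toClosedSubmodule ↔
      W.modularConj.toEquiv (V.modularConj.toEquiv x) ∈ W.toClosedSubmodule := by
  rw [reflect, mem_conjImage, mem_conjImage]

/-- The modular conjugation of `V • W` is `J_V J_W J_V`. -/
lemma modularConj_reflect (V W : StandardSubspace H) :
    (V.reflect W).modularConj = V.modularConj.conjConj W.modularConj := by
  rw [reflect, modularConj_conjImage, modularConj_conjImage]
  apply Conjugation.ext_of_apply
  simp [Conjugation.apply_apply]

theorem isReflectionSpace_reflect : IsReflectionSpace (reflect (H := H)) where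
  self V := eq_of_mem_iff fun x => by
    rw [mem_reflect_iff, Conjugation.apply_apply]
  involutive V W := eq_of_mem_iff fun x => by
    simp [mem_reflect_iff, modularConj_reflect, Conjugation.apply_apply]
  distrib U V W := eq_of_mem_iff fun x => by
    simp [mem_reflect_iff, modularConj_reflect, Conjugation.apply_apply]

variable (J : Conjugation H)

theorem isTrivialReflectionSubspace_fibre :
    IsTrivialReflectionSubspace reflect (fibre J) := by
  intro V hV W hW
  have h : V.reflect W = W := eq_of_mem_iff fun x => by
    rw [mem_reflect_iff, show V.modularConj = J from hV, show W.modularConj = J from hW,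
      J.apply_apply]
  rw [h]
  exact ⟨hW, rfl⟩

variable {J}

theorem smul_mem_fibre {h : H ≃ₗᵢ[ℂ] H} (hh : h ∈ J.fixedUnitary) {V : StandardSubspace H}
    (hV : V ∈ fibre J) : h • V ∈ fibre J := by
  change (h • V).modularConj = J
  rw [modularConj_smul, show V.modularConj = J from hV]
  apply Conjugation.ext_of_apply
  intro x
  have h1 := DFunLike.congr_fun (J.mem_fixedUnitary.1 hh) (h.symm x)
  rw [J.tau_apply, h.apply_symm_apply] at h1
  rw [Conjugation.unitaryConj_apply, ← J.apply_apply (h _), h1]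

theorem smul_fibre_surjective :
    Function.Surjective (fun p : (H ≃ₗᵢ[ℂ] H) × fibre J => p.1 • (p.2 : StandardSubspace H)) := by
  intro W
  obtain ⟨g, hg⟩ := J.exists_unitaryConj_eq W.modularConj
  refine ⟨(g, ⟨g⁻¹ • W, ?_⟩), smul_inv_smul g W⟩
  change (g⁻¹ • W).modularConj = J
  rw [modularConj_smul, ← hg]
  apply Conjugation.ext_of_apply
  intro x
  change g.symm (g (J.toEquiv (g.symm (g x)))) = J.toEquiv x
  simp

namespace LoosBundle

lemma toStand_injective : Function.Injective (toStand (J := J)) := by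
  rintro ⟨g, V, hV⟩ ⟨g', V', hV'⟩ h
  replace h : g • V = g' • V' := h
  have hV1 : V.modularConj = J := hV
  have hV2 : V'.modularConj = J := hV'
  refine Quotient.sound ⟨g'⁻¹ * g, ?_, by simp, ?_⟩
  · have h1 := congrArg (fun W => W.modularConj) h
    simp only [modularConj_smul, hV1, hV2] at h1
    rw [Conjugation.mem_fixedUnitary]
    ext x
    have h2 := congrArg (fun K : Conjugation H => K.toEquiv (g x)) h1
    simp only [Conjugation.unitaryConj_apply, g.symm_apply_apply] at h2
    change J.toEquiv (g'.symm (g (J.toEquiv x))) = g'.symm (g x)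
    rw [h2, g'.symm_apply_apply, J.apply_apply]
  · change V' = (g'⁻¹ * g) • V
    rw [mul_smul, h, inv_smul_smul]

theorem toStand_bijective : Function.Bijective (toStand (J := J)) := by
  refine ⟨toStand_injective, fun W => ?_⟩
  obtain ⟨⟨g, V⟩, h⟩ := smul_fibre_surjective (J := J) W
  exact ⟨mk g V, h⟩

theorem toStand_translate (g : H ≃ₗᵢ[ℂ] H) (x : LoosBundle J) :
    (x.translate g).toStand = g • x.toStand := by
  obtain ⟨g', V⟩ := x
  exact mul_smul g g' (V : StandardSubspace H)

theorem toStand_isReflectionMorphism :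
    IsReflectionMorphism (reflect (J := J)) StandardSubspace.reflect toStand := by
  rintro ⟨g, V⟩ ⟨g', V'⟩
  change (g * J.tau (g⁻¹ * g')) • (V' : StandardSubspace H) =
    (g • (V : StandardSubspace H)).reflect (g' • (V' : StandardSubspace H))
  have hV : (V : StandardSubspace H).modularConj = J := V.2
  have hV' : (V' : StandardSubspace H).modularConj = J := V'.2
  refine eq_of_mem_iff fun x => ?_
  rw [mem_reflect_iff, modularConj_smul, modularConj_smul, hV, hV', mem_smul_iff, mem_smul_iff,
    Conjugation.unitaryConj_apply, Conjugation.unitaryConj_apply, g'.symm_apply_apply]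
  -- the inverse of `g τ(g⁻¹ g')` is `J g'⁻¹ g J g⁻¹`
  have h1 : (g * J.tau (g⁻¹ * g')).symm x =
      J.toEquiv (g'.symm (g (J.toEquiv (g.symm x)))) := by
    rw [LinearIsometryEquiv.symm_apply_eq]
    change x = g (J.toEquiv (g.symm (g' (J.toEquiv (J.toEquiv _)))))
    simp [J.apply_apply]
  rw [h1]

/-- The axioms are reflected by the injective morphism `[g, V] ↦ gV`. -/
theorem isReflectionSpace_reflect : IsReflectionSpace (reflect (J := J)) where
  self x := toStand_injective <| by
    rw [toStand_isReflectionMorphism, StandardSubspace.isReflectionSpace_reflect.self]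
  involutive x y := toStand_injective <| by
    rw [toStand_isReflectionMorphism, toStand_isReflectionMorphism,
      StandardSubspace.isReflectionSpace_reflect.involutive]
  distrib x y z := toStand_injective <| by
    simp only [toStand_isReflectionMorphism _ _]
    exact StandardSubspace.isReflectionSpace_reflect.distrib _ _ _

end LoosBundle

end StandardSubspace

theorem mainTheorem10 {H : Type*} [NormedAddCommGroup H] [InnerProductSpace ℂ H] [CompleteSpace H]
    (J : Conjugation H) :
    -- `J_V` is the unique conjugation in the polar decomposition of the Tomita operator of `V`
    (∀ (V : StandardSubspace H) (K : Conjugation H),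
      V.IsModularConjugation K ↔ K = V.modularConj) ∧
    -- restriction to `H^J` identifies `U(H)^τ` with `O(H^J)`, and this group acts on the fibre
    Function.Bijective J.restrict ∧
    (∀ h ∈ J.fixedUnitary, ∀ V ∈ StandardSubspace.fibre J, h • V ∈ StandardSubspace.fibre J) ∧
    -- the map `(g, V) ↦ gV` is surjective
    Function.Surjective (fun p : (H ≃ₗᵢ[ℂ] H) × StandardSubspace.fibre J =>
      p.1 • (p.2 : StandardSubspace H)) ∧
    -- the factored map is an equivariant isomorphism of reflection spaces
    IsReflectionSpace (StandardSubspace.reflect (H := H)) ∧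
    IsReflectionSpace (StandardSubspace.LoosBundle.reflect (J := J)) ∧
    Function.Bijective (StandardSubspace.LoosBundle.toStand (J := J)) ∧
    (∀ (g : H ≃ₗᵢ[ℂ] H) (x : StandardSubspace.LoosBundle J), (x.translate g).toStand = g • x.toStand) ∧
    IsReflectionMorphism (StandardSubspace.LoosBundle.reflect (J := J)) StandardSubspace.reflect
      StandardSubspace.LoosBundle.toStand ∧
    -- the fibre is a trivial reflection subspace
    IsTrivialReflectionSubspace StandardSubspace.reflect (StandardSubspace.fibre J) := by
  exact ⟨StandardSubspace.isModularConjugation_iff, J.restrict_bijective,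
    fun _ hh _ hV => StandardSubspace.smul_mem_fibre hh hV,
    StandardSubspace.smul_fibre_surjective, StandardSubspace.isReflectionSpace_reflect,
    StandardSubspace.LoosBundle.isReflectionSpace_reflect,
    StandardSubspace.LoosBundle.toStand_bijective,
    StandardSubspace.LoosBundle.toStand_translate,
    StandardSubspace.LoosBundle.toStand_isReflectionMorphism,
    StandardSubspace.isTrivialReflectionSubspace_fibre J⟩
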